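/- Let $(\Omega,\mathcal F,\mathbb P)$ be a probability space and $\rho$ a random variable with $\mathbb P(\rho>0)=1$ and $\mathrm E[\rho]<\infty$. Let $U:(0,\infty)\to\mathbb R$ be continuously differentiable, strictly increasing and strictly concave with $\lim_{y\downarrow0}U'(y)=\infty$, $\lim_{y\to\infty}U'(y)=0$ and $\limsup_{y\to\infty}\frac{yU'(y)}{U(y)}<1$; put $U(0)=\lim_{y\downarrow0}U(y)\in[-\infty,\infty)$ and $U'(0)=\infty$. Let $L^0_+$ be the set of random variables $X$ with $X\ge0$ a.s., and for $x>0$ let $\mathscr X(x)=\{X\in L^0_+ : \mathrm E[\rho X]\le x\}$. Expected utilities are $\mathrm E[U(X)]=\mathrm E[U(X)^+]-\mathrm E[U(X)^-]$, with $\infty-\infty=-\infty$. Assume that $\sup_{X\in\mathscr X(x)}\mathrm E[U(X)]<\infty$ for some $x>0$. Let $m$ be a probability measure with $m([a_0,a_1])=1$ for some $0<a_0<a_1<\infty$, and for $X\in L^0_+$ define the weighted entropic risk measure and its marginal $$h(X)=\int_{[a_0,a_1]}\frac1a\log\mathrm E[e^{-aX}]\,m(da),\qquad h'(X)=-\int_{[a_0,a_1]}\frac{e^{-aX}}{\mathrm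 E[e^{-aX}]}\,m(da).$$ Let $x>0$. The problem of maximizing $\mathrm E[U(X)]$ over $X\in\mathscr X(x)$ has an a.s. unique solution $X_{\circ x}$. Put $\gamma_1(x)=\inf_{X\in\mathscr X(x)}h(X)$ and $\gamma_2(x)=h(X_{\circ x})$. Then for every $\gamma\in(\gamma_1(x),\gamma_2(x))$ the problem $$\text{maximize } \mathrm E[U(X)]\quad\text{over } X\in\mathscr X(x)\quad\text{subject to } h(X)\le\gamma$$ has an a.s. unique solution. Moreover, $X^*\in L^0_+$ is a solution if and only if there are $\lambda>0$ and $\mu>0$ such that $$U'(X^*)-\mu h'(X^*)-\lambda\rho=0\ \text{ a.s.},\qquad \mathrm E[\rho X^*]=x,\qquad h(X^*)=\gamma.$$ -/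

import Mathlib

open MeasureTheory Filter Topology Set

namespace WERM

/-- A utility function on `(0, ∞)`: continuously differentiable, strictly increasing, strictly
concave, and subject to the Inada conditions `U'(0+) = ∞`, `U'(∞) = 0`. The values of `U` outside
`(0, ∞)` play no role. -/
structure IsUtility (U : ℝ → ℝ) : Prop where
  contDiffOn : ContDiffOn ℝ 1 U (Ioi 0)
  strictMonoOn : StrictMonoOn U (Ioi 0)
  strictConcaveOn : StrictConcaveOn ℝ (Ioi 0) U
  inada_zero : Tendsto (deriv U) (𝓝[>] 0) atTop
  inada_top : Tendsto (deriv U) atTop (𝓝 0)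

/-- The asymptotic elasticity `limsup_{x → ∞} x U'(x) / U(x)`, as an extended real. -/
noncomputable def asymptoticElasticity (U : ℝ → ℝ) : EReal :=
  limsup (fun x : ℝ => ((x * deriv U x / U x : ℝ) : EReal)) atTop

/-- The utility function extended to wealth `0` by `U(0) = lim_{y ↓ 0} U(y) ∈ [-∞, ∞)`, which is
the infimum of `U` over `(0, ∞)` since `U` is increasing. -/
noncomputable def extUtility (U : ℝ → ℝ) (y : ℝ) : EReal :=
  if 0 < y then (U y : EReal) else ⨅ z ∈ Ioi (0 : ℝ), (U z : EReal)

variable {Ω : Type*} [MeasurableSpace Ω]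

/-- The expected utility `E[U(X)] = E[U(X)⁺] - E[U(X)⁻]` in `[-∞, ∞]`. In `EReal` one has
`⊤ - ⊤ = ⊥`, so `E[U(X)] = -∞` as soon as `E[U(X)⁻] = ∞`. -/
noncomputable def expectedUtility (P : Measure Ω) (U : ℝ → ℝ) (X : Ω → ℝ) : EReal :=
  ((∫⁻ ω, (extUtility U (X ω)).toENNReal ∂P : ENNReal) : EReal) -
    ((∫⁻ ω, (-extUtility U (X ω)).toENNReal ∂P : ENNReal) : EReal)

/-- The random variables that are almost surely nonnegative. -/
def L0Plus (P : Measure Ω) : Set (Ω → ℝ) :=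
  {X | Measurable X ∧ ∀ᵐ ω ∂P, 0 ≤ X ω}

/-- The cost `E[ρ X] ∈ [0, ∞]` of an almost surely nonnegative payoff `X`, where `ρ` is almost
surely positive. -/
noncomputable def cost (P : Measure Ω) (ρ X : Ω → ℝ) : ENNReal :=
  ∫⁻ ω, ENNReal.ofReal (ρ ω * X ω) ∂P

/-- The terminal wealths that are affordable with initial capital `x`. -/
def affordable (P : Measure Ω) (ρ : Ω → ℝ) (x : ℝ) : Set (Ω → ℝ) :=
  {X | X ∈ L0Plus P ∧ cost P ρ X ≤ ENNReal.ofReal x}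

/-- The value `u(x)` of expected utility maximization without risk constraint. -/
noncomputable def euValue (P : Measure Ω) (ρ : Ω → ℝ) (U : ℝ → ℝ) (x : ℝ) : EReal :=
  ⨆ X ∈ affordable P ρ x, expectedUtility P U X

/-- The weighted entropic risk measure `h(X) = ∫ (1/a) log E[exp(-a X)] m(da)` with weighting
measure `m`; here `cgf X P (-a) = log E[exp(-a X)]`. -/
noncomputable def werm (P : Measure Ω) (m : Measure ℝ) (X : Ω → ℝ) : ℝ :=
  ∫ a, 1 / a * ProbabilityTheory.cgf X P (-a) ∂m

/-- The random variable `h'(X) = -∫ exp(-a X) / E[exp(-a X)] m(da)`; here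
`mgf X P (-a) = E[exp(-a X)]`. -/
noncomputable def wermDeriv (P : Measure Ω) (m : Measure ℝ) (X : Ω → ℝ) (ω : Ω) : ℝ :=
  -∫ a, Real.exp (-a * X ω) / ProbabilityTheory.mgf X P (-a) ∂m

/-- The minimal risk `γ₁(x)` over the wealths affordable with capital `x`. -/
noncomputable def minRisk (P : Measure Ω) (m : Measure ℝ) (ρ : Ω → ℝ) (x : ℝ) : EReal :=
  ⨅ X ∈ affordable P ρ x, (werm P m X : EReal)

/-- The affordable wealths whose risk is at most `γ`. -/
def riskFeasible (P : Measure Ω) (m : Measure ℝ) (ρ : Ω → ℝ) (x γ : ℝ) : Set (Ω → ℝ) :=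
  {X | X ∈ affordable P ρ x ∧ werm P m X ≤ γ}

/-- `X` maximizes expected utility over the set `S`. -/
def Solves (P : Measure Ω) (U : ℝ → ℝ) (S : Set (Ω → ℝ)) (X : Ω → ℝ) : Prop :=
  X ∈ S ∧ ∀ Y ∈ S, expectedUtility P U Y ≤ expectedUtility P U X

/-- `X` maximizes expected utility over `S`, and every maximizer equals `X` almost surely. -/
def SolvesUniquely (P : Measure Ω) (U : ℝ → ℝ) (S : Set (Ω → ℝ)) (X : Ω → ℝ) : Prop :=
  Solves P U S X ∧ ∀ Y, Solves P U S Y → Y =ᵐ[P] X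

/-- The first-order condition `U'(X) - μ h'(X) - λ ρ = 0` a.s. Since `U'(0) = ∞`, the condition
includes that `X > 0` a.s. -/
def FirstOrderCondition (P : Measure Ω) (m : Measure ℝ) (ρ : Ω → ℝ) (U : ℝ → ℝ) (lam mu : ℝ)
    (X : Ω → ℝ) : Prop :=
  ∀ᵐ ω ∂P, 0 < X ω ∧ deriv U (X ω) - mu * wermDeriv P m X ω - lam * ρ ω = 0

end WERM

namespace WERM

/-! ### Concavity estimates for the utility function. -/

section Utility

variable {U : ℝ → ℝ}

/-! This is convex duality for a concave objective under two convex constraints: the linear budget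
and the risk constraint. For `γ` above the minimal risk, mixing a low-risk wealth with a small
constant gives a strictly feasible point (`exists_slater`), so separating the convex set of
attainable (utility, cost, risk) triples from the optimum yields multipliers `λ, μ ≥ 0`
(`exists_multipliers`). A maximizer of the Lagrangian must annihilate its derivative in every
direction `1_A` with `X` bounded away from `0` on `A`; this is the first-order condition
(`firstOrderCondition_of_lagrange`). Since `U' > 0`, `μ ≥ 0` and `h' < 0`, it forces `λ > 0`, and
the budget binds by complementary slackness.

Existence of the maximizer is the analytic core. Finiteness of the value function at one capital
gives an integrable majorant of `U(y) - κρy` for one `κ`, and asymptotic elasticity below `1`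
extends this to every `κ > 0` (`hasMajorant`). Strict concavity makes `exp(-X_n)` Cauchy in `L¹`
along a maximizing sequence (`exists_midpoint_gap`, `exists_subseq_tendsto_ae`), so a subsequence
converges a.s. The budget rules out the limit `∞`, and the Inada condition at `0` rules out the
limit `0` (`ae_pos_of_tendsto`). Fatou's lemma with the majorants for all small `κ` shows that no
utility is lost in the limit.

Conversely, tangent inequalities for `U` and `h` show that the optimality system is sufficient, and
strict concavity gives uniqueness (`solvesUniquely_of_firstOrderCondition`). Because `h ≤ 0` on
nonnegative wealths, the unconstrained problem is the case `γ = 1`. Finally, `μ = 0` would make the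
constrained optimum solve the unconstrained problem, which is impossible when `γ < γ₂(x)`. -/

theorem IsUtility.hasDerivAt (hU : IsUtility U) {y : ℝ} (hy : 0 < y) :
    HasDerivAt U (deriv U y) y :=
  ((hU.contDiffOn.differentiableOn one_ne_zero).differentiableAt (Ioi_mem_nhds hy)).hasDerivAt

theorem IsUtility.continuousOn (hU : IsUtility U) : ContinuousOn U (Ioi 0) :=
  hU.contDiffOn.continuousOn

theorem IsUtility.continuousOn_deriv (hU : IsUtility U) : ContinuousOn (deriv U) (Ioi 0) :=
  hU.contDiffOn.continuousOn_deriv_of_isOpen isOpen_Ioi le_rfl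

/-- The graph of `U` lies strictly below its tangents. -/
theorem IsUtility.lt_tangent (hU : IsUtility U) {y z : ℝ} (hy : 0 < y) (hz : 0 < z)
    (hne : z ≠ y) : U z < U y + deriv U y * (z - y) := by
  have hd := (hU.hasDerivAt hy).differentiableAt
  rcases lt_or_gt_of_ne hne with h | h
  · have := hU.strictConcaveOn.deriv_lt_slope hz hy h hd
    rw [slope_def_field, lt_div_iff₀ (by linarith)] at this
    linarith
  · have := hU.strictConcaveOn.slope_lt_deriv hy hz h hd
    rw [slope_def_field, div_lt_iff₀ (by linarith)] at this
    linarith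

theorem IsUtility.le_tangent (hU : IsUtility U) {y z : ℝ} (hy : 0 < y) (hz : 0 < z) :
    U z ≤ U y + deriv U y * (z - y) := by
  rcases eq_or_ne z y with rfl | h
  · simp
  · exact (hU.lt_tangent hy hz h).le

theorem IsUtility.mono (hU : IsUtility U) {y z : ℝ} (hy : 0 < y) (h : y ≤ z) : U y ≤ U z :=
  hU.strictMonoOn.monotoneOn hy (hy.trans_le h) h

theorem IsUtility.deriv_pos (hU : IsUtility U) {y : ℝ} (hy : 0 < y) : 0 < deriv U y := by
  have h1 := hU.lt_tangent hy (by linarith : 0 < y + 1) (by linarith)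
  have h2 := hU.mono hy (by linarith : y ≤ y + 1)
  linarith

theorem IsUtility.deriv_strictAntiOn (hU : IsUtility U) : StrictAntiOn (deriv U) (Ioi 0) := by
  intro y hy z hz h
  have h1 := hU.lt_tangent hy hz h.ne'
  have h2 := hU.lt_tangent hz hy h.ne
  by_contra! h3
  nlinarith

theorem IsUtility.exists_deriv_eq (hU : IsUtility U) {p : ℝ} (hp : 0 < p) :
    ∃ y, 0 < y ∧ deriv U y = p := by
  obtain ⟨y, hy0, hy⟩ := ((hU.inada_zero.eventually_ge_atTop p).and
    self_mem_nhdsWithin).exists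
  obtain ⟨z, hz, hz0⟩ := ((hU.inada_top.eventually_lt_const hp).and (eventually_gt_atTop 0)).exists
  have hsub : uIcc z y ⊆ Ioi 0 := fun w hw =>
    lt_of_lt_of_le (lt_min (mem_Ioi.1 hz0) hy) hw.1
  obtain ⟨w, hw, hwp⟩ := intermediate_value_uIcc (hU.continuousOn_deriv.mono hsub)
    (show p ∈ uIcc (deriv U z) (deriv U y) by
      rw [uIcc_of_le (hz.le.trans hy0)]; exact ⟨hz.le, hy0⟩)
  exact ⟨w, hsub hw, hwp⟩

open Classical in
/-- The inverse `I` of the marginal utility `U'`, set to `0` outside `(0, ∞)`. -/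
noncomputable def invMarginal (U : ℝ → ℝ) (p : ℝ) : ℝ :=
  if h : ∃ y, 0 < y ∧ deriv U y = p then h.choose else 0

theorem IsUtility.invMarginal_pos (hU : IsUtility U) {p : ℝ} (hp : 0 < p) :
    0 < invMarginal U p := by
  have h := hU.exists_deriv_eq hp
  rw [invMarginal, dif_pos h]
  exact h.choose_spec.1

theorem IsUtility.deriv_invMarginal (hU : IsUtility U) {p : ℝ} (hp : 0 < p) :
    deriv U (invMarginal U p) = p := by
  have h := hU.exists_deriv_eq hp
  rw [invMarginal, dif_pos h]
  exact h.choose_spec.2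

theorem IsUtility.invMarginal_of_nonpos (hU : IsUtility U) {p : ℝ} (hp : p ≤ 0) :
    invMarginal U p = 0 := by
  rw [invMarginal, dif_neg]
  rintro ⟨y, hy, h⟩
  have := hU.deriv_pos hy
  linarith

theorem IsUtility.measurable_invMarginal (hU : IsUtility U) : Measurable (invMarginal U) := by
  refine measurable_of_Iio fun t => ?_
  by_cases ht : 0 < t
  -- The half-line `p ≤ 0` belongs to the preimage because of the default value `0` of
  -- `invMarginal`.
  · have : invMarginal U ⁻¹' Iio t = Iic 0 ∪ Ioi (deriv U t) := by
      ext p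
      simp only [mem_preimage, mem_Iio, mem_union, mem_Iic, mem_Ioi]
      rcases le_or_gt p 0 with hp | hp
      · simp [hU.invMarginal_of_nonpos hp, hp, ht]
      · rw [← hU.deriv_strictAntiOn.lt_iff_gt (show t ∈ Ioi 0 from ht) (hU.invMarginal_pos hp),
          hU.deriv_invMarginal hp]
        simp [hp.not_ge]
    rw [this]
    exact measurableSet_Iic.union measurableSet_Ioi
  · have : invMarginal U ⁻¹' Iio t = ∅ := by
      ext p
      simp only [mem_preimage, mem_Iio, mem_empty_iff_false, iff_false, not_lt]
      rcases le_or_gt p 0 with hp | hp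
      · rw [hU.invMarginal_of_nonpos hp]; linarith
      · linarith [hU.invMarginal_pos hp]
    rw [this]
    exact MeasurableSet.empty

/-- `I(p)` maximizes `U(y) - p y`. -/
theorem IsUtility.sub_mul_le (hU : IsUtility U) {p y : ℝ} (hp : 0 < p) (hy : 0 < y) :
    U y - p * y ≤ U (invMarginal U p) - p * invMarginal U p := by
  have := hU.le_tangent (hU.invMarginal_pos hp) hy
  rw [hU.deriv_invMarginal hp] at this
  linarith

theorem IsUtility.aestronglyMeasurable_comp {Ω : Type*} [MeasurableSpace Ω] {P : Measure Ω}
    (hU : IsUtility U) {X : Ω → ℝ} (hX : Measurable X) (hpos : ∀ᵐ ω ∂P, 0 < X ω) :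
    AEStronglyMeasurable (fun ω => U (X ω)) P := by
  classical
  have h : Measurable (fun y => if y ∈ Ioi (0 : ℝ) then U y else 0) :=
    hU.continuousOn.measurable_piecewise continuousOn_const measurableSet_Ioi
  refine (h.comp hX).aestronglyMeasurable.congr ?_
  filter_upwards [hpos] with ω hω
  simp [hω]

/-- Concave functions have decreasing increments. -/
theorem increment_le_of_concaveOn {f : ℝ → ℝ} {S : Set ℝ} (hf : ConcaveOn ℝ S f) {a b s : ℝ}
    (ha : a ∈ S) (hb : b + s ∈ S) (hab : a ≤ b) (hs : 0 < s) :
    f (b + s) - f b ≤ f (a + s) - f a := by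
  have hd : 0 < b + s - a := by linarith
  have hp : 0 ≤ (b - a) / (b + s - a) := div_nonneg (by linarith) hd.le
  have hq : 0 ≤ s / (b + s - a) := div_nonneg hs.le hd.le
  have hpq : (b - a) / (b + s - a) + s / (b + s - a) = 1 := by field_simp; ring
  -- The points `a + s` and `b` are convex combinations of `a` and `b + s` with interchanged
  -- weights, so the two concavity inequalities add up to the claim.
  have h1 := hf.2 ha hb hp hq hpq
  have h2 := hf.2 ha hb hq hp (by rw [add_comm]; exact hpq)
  simp only [smul_eq_mul] at h1 h2
  rw [show (b - a) / (b + s - a) * a + s / (b + s - a) * (b + s) = a + s by field_simp; ring] at h1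
  rw [show s / (b + s - a) * a + (b - a) / (b + s - a) * (b + s) = b by field_simp; ring] at h2
  have h3 : (b - a) / (b + s - a) = 1 - s / (b + s - a) := by field_simp; ring
  rw [h3] at h1 h2
  nlinarith

/-- The strict concavity of `U` at the midpoint is bounded below on pairs that are separated in
the metric of `[0, ∞]`. -/
theorem IsUtility.exists_midpoint_gap (hU : IsUtility U) {ε : ℝ} (hε : 0 < ε) :
    ∃ δ > 0, ∀ y z : ℝ, 0 < y → 0 < z → ε ≤ |Real.exp (-y) - Real.exp (-z)| →
      δ ≤ U ((y + z) / 2) - (U y + U z) / 2 := by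
  have hcc := hU.strictConcaveOn.concaveOn
  -- The midpoint gap of the pair `y + ε/2 < y + ε`. The shift by `ε/2` keeps both points positive
  -- at `y = 0`, so `g` is continuous up to the boundary and has a positive minimum on a compact
  -- interval.
  set g : ℝ → ℝ := fun y => U ((y + ε / 2 + (y + ε)) / 2) - (U (y + ε / 2) + U (y + ε)) / 2 with hg
  have hgc : ContinuousOn g (Icc 0 |Real.log ε|) := by
    have hm : ∀ c : ℝ → ℝ, Continuous c → (∀ y, 0 ≤ y → 0 < c y) →
        ContinuousOn (fun y => U (c y)) (Icc 0 |Real.log ε|) := fun c hc hpos =>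
      hU.continuousOn.comp hc.continuousOn fun y hy => hpos y hy.1
    exact (hm (fun y => (y + ε / 2 + (y + ε)) / 2) (by fun_prop) fun y hy => by linarith).sub
      (((hm (fun y => y + ε / 2) (by fun_prop) fun y hy => by linarith).add
        (hm (fun y => y + ε) (by fun_prop) fun y hy => by linarith)).div_const 2)
  obtain ⟨y₀, hy₀, hmin⟩ := isCompact_Icc.exists_isMinOn
    (nonempty_Icc.2 (abs_nonneg (Real.log ε))) hgc
  have hpos : 0 < g y₀ := by
    have h0 := hy₀.1
    have h := hU.strictConcaveOn.2 (show y₀ + ε / 2 ∈ Ioi (0 : ℝ) by simp; linarith)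
      (show y₀ + ε ∈ Ioi (0 : ℝ) by simp; linarith) (by linarith)
      (show (0 : ℝ) < 1 / 2 by norm_num) (show (0 : ℝ) < 1 / 2 by norm_num) (by norm_num)
    simp only [smul_eq_mul] at h
    rw [show 1 / 2 * (y₀ + ε / 2) + 1 / 2 * (y₀ + ε) = (y₀ + ε / 2 + (y₀ + ε)) / 2 by ring] at h
    simp only [hg]
    linarith
  have key : ∀ y z : ℝ, 0 < y → y < z → ε ≤ |Real.exp (-y) - Real.exp (-z)| →
      g y₀ ≤ U ((y + z) / 2) - (U y + U z) / 2 := by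
    intro y z hy hyz h
    have hlt : Real.exp (-z) < Real.exp (-y) := Real.exp_lt_exp.2 (by linarith)
    rw [abs_of_pos (by linarith)] at h
    -- Separation in `exp(-·)` confines the smaller point to a compact interval and, since `exp(-·)`
    -- is 1-Lipschitz on `[0, ∞)`, puts the larger one at distance at least `ε`.
    have hyK : y ≤ |Real.log ε| := by
      have h1 : ε ≤ Real.exp (-y) := by linarith [Real.exp_pos (-z)]
      have h2 := (Real.log_le_iff_le_exp hε).2 h1
      linarith [neg_abs_le (Real.log ε)]
    have hzy : y + ε ≤ z := by
      have h1 : Real.exp (-z) = Real.exp (-y) * Real.exp (-(z - y)) := by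
        rw [← Real.exp_add]; congr 1; ring
      have h2 := Real.add_one_le_exp (-(z - y))
      have h3 : Real.exp (-y) ≤ 1 := Real.exp_le_one_iff.2 (by linarith)
      nlinarith [Real.exp_pos (-y)]
    have hmy := hmin (show y ∈ Icc 0 |Real.log ε| from ⟨hy.le, hyK⟩)
    refine le_trans hmy ?_
    simp only [hg]
    have hS : ∀ w : ℝ, 0 < w → w ∈ Ioi (0 : ℝ) := fun w hw => hw
    -- Enlarging an interval increases its midpoint gap: `step1` moves the left endpoint from `y +
    -- ε/2` to `y`, `step2` the right endpoint from `y + ε` to `z`.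
    have step1 : U ((y + ε / 2 + (y + ε)) / 2) - U ((y + (y + ε)) / 2) ≤
        (U (y + ε / 2) - U y) / 2 := by
      have a1 := increment_le_of_concaveOn hcc (a := y + ε / 4) (b := (y + (y + ε)) / 2)
        (s := ε / 4) (hS _ (by linarith)) (hS _ (by linarith)) (by linarith) (by linarith)
      have a2 := increment_le_of_concaveOn hcc (a := y) (b := y + ε / 4)
        (s := ε / 4) (hS _ (by linarith)) (hS _ (by linarith)) (by linarith) (by linarith)
      rw [show (y + (y + ε)) / 2 + ε / 4 = (y + ε / 2 + (y + ε)) / 2 by ring] at a1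
      rw [show y + ε / 4 + ε / 4 = y + ε / 2 by ring] at a1 a2
      linarith
    have step2 : (U z - U (y + ε)) / 2 ≤ U ((y + z) / 2) - U ((y + (y + ε)) / 2) := by
      rcases hzy.eq_or_lt with h | hlt'
      · rw [← h]; simp
      have a1 := increment_le_of_concaveOn hcc (a := (y + (y + ε)) / 2) (b := y + ε)
        (s := (z - (y + ε)) / 2) (hS _ (by linarith)) (hS _ (by linarith)) (by linarith)
        (by linarith)
      have a2 := increment_le_of_concaveOn hcc (a := (y + (y + ε)) / 2)
        (b := y + ε + (z - (y + ε)) / 2)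
        (s := (z - (y + ε)) / 2) (hS _ (by linarith)) (hS _ (by linarith)) (by linarith)
        (by linarith)
      rw [show (y + (y + ε)) / 2 + (z - (y + ε)) / 2 = (y + z) / 2 by ring] at a1 a2
      rw [show y + ε + (z - (y + ε)) / 2 + (z - (y + ε)) / 2 = z by ring] at a2
      linarith
    linarith
  refine ⟨g y₀, hpos, fun y z hy hz h => ?_⟩
  rcases lt_trichotomy y z with hyz | rfl | hyz
  · exact key y z hy hyz h
  · simp at h; linarith
  · rw [abs_sub_comm] at h
    rw [add_comm y z, add_comm (U y)]
    exact key z y hz hyz h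

theorem IsUtility.midpoint_le (hU : IsUtility U) {y z : ℝ} (hy : 0 < y) (hz : 0 < z) :
    (U y + U z) / 2 ≤ U ((y + z) / 2) := by
  have h := hU.strictConcaveOn.concaveOn.2 (show y ∈ Ioi (0 : ℝ) from hy)
    (show z ∈ Ioi (0 : ℝ) from hz) (show (0 : ℝ) ≤ 1 / 2 by norm_num)
    (show (0 : ℝ) ≤ 1 / 2 by norm_num) (by norm_num)
  simp only [smul_eq_mul] at h
  rw [show 1 / 2 * y + 1 / 2 * z = (y + z) / 2 by ring] at h
  linarith

end Utility

/-! ### The weighted entropic risk measure: convexity, continuity and derivative. -/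

section Risk

open ProbabilityTheory

variable {Ω : Type*} [MeasurableSpace Ω] {P : Measure Ω} {m : Measure ℝ}
  {X Y : Ω → ℝ} {a a₀ a₁ : ℝ}

theorem werm_congr (h : X =ᵐ[P] Y) : werm P m X = werm P m Y := by
  unfold werm cgf
  simp_rw [mgf_congr h]

theorem wermDeriv_congr (h : X =ᵐ[P] Y) : wermDeriv P m X =ᵐ[P] wermDeriv P m Y := by
  filter_upwards [h] with ω hω
  unfold wermDeriv
  simp_rw [mgf_congr h, hω]

theorem L0Plus_convex_comb (hX : X ∈ L0Plus P) (hY : Y ∈ L0Plus P) {p q : ℝ} (hp : 0 ≤ p)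
    (hq : 0 ≤ q) : (fun ω => p * X ω + q * Y ω) ∈ L0Plus P := by
  refine ⟨(hX.1.const_mul p).add (hY.1.const_mul q), ?_⟩
  filter_upwards [hX.2, hY.2] with ω h1 h2
  positivity

variable [IsProbabilityMeasure P] [IsProbabilityMeasure m]

theorem exp_neg_mul_le_one (ha : 0 ≤ a) {y : ℝ} (hy : 0 ≤ y) : Real.exp (-a * y) ≤ 1 :=
  Real.exp_le_one_iff.2 (by nlinarith)

theorem integrable_exp_neg_mul (hX : X ∈ L0Plus P) (ha : 0 ≤ a) :
    Integrable (fun ω => Real.exp (-a * X ω)) P := by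
  have hm := hX.1
  refine Integrable.of_bound (C := 1) (by fun_prop) ?_
  filter_upwards [hX.2] with ω hω
  rw [Real.norm_of_nonneg (Real.exp_pos _).le]
  exact exp_neg_mul_le_one ha hω

theorem mgf_neg_pos (hX : X ∈ L0Plus P) (ha : 0 ≤ a) : 0 < mgf X P (-a) :=
  mgf_pos (integrable_exp_neg_mul hX ha)

theorem mgf_neg_anti (hX : X ∈ L0Plus P) (hY : Y ∈ L0Plus P) (ha : 0 ≤ a)
    (h : ∀ᵐ ω ∂P, X ω ≤ Y ω) : mgf Y P (-a) ≤ mgf X P (-a) := by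
  refine integral_mono_ae (integrable_exp_neg_mul hY ha) (integrable_exp_neg_mul hX ha) ?_
  filter_upwards [h] with ω hω
  exact Real.exp_le_exp.2 (by nlinarith)

theorem mgf_neg_le_one (hX : X ∈ L0Plus P) (ha : 0 ≤ a) : mgf X P (-a) ≤ 1 := by
  have h := mgf_neg_anti (X := fun _ => 0) (P := P) ⟨measurable_const, by simp⟩ hX ha hX.2
  simpa [mgf] using h

theorem mgf_neg_le_mgf_neg (hX : X ∈ L0Plus P) {b : ℝ} (ha : 0 ≤ a) (hab : a ≤ b) :
    mgf X P (-b) ≤ mgf X P (-a) := by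
  refine integral_mono_ae (integrable_exp_neg_mul hX (ha.trans hab))
    (integrable_exp_neg_mul hX ha) ?_
  filter_upwards [hX.2] with ω hω
  exact Real.exp_le_exp.2 (by nlinarith)

theorem measurable_integral_exp_neg_mul (hX : Measurable X) (ν : Measure Ω) [SFinite ν] :
    Measurable fun a : ℝ => ∫ ω, Real.exp (-a * X ω) ∂ν := by
  have h : StronglyMeasurable (Function.uncurry fun (a : ℝ) (ω : Ω) => Real.exp (-a * X ω)) :=
    Measurable.stronglyMeasurable (by fun_prop)
  exact h.integral_prod_right.measurable

theorem measurable_mgf_neg (hX : Measurable X) : Measurable fun a : ℝ => mgf X P (-a) :=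
  measurable_integral_exp_neg_mul hX P

theorem measurable_werm_integrand (hX : Measurable X) :
    Measurable fun a : ℝ => 1 / a * cgf X P (-a) := by
  have := measurable_mgf_neg (P := P) hX
  unfold cgf
  fun_prop

theorem ae_mem_Icc (hm : m (Icc a₀ a₁) = 1) : ∀ᵐ a ∂m, a ∈ Icc a₀ a₁ := by
  rw [ae_mem_iff_measure_eq measurableSet_Icc.nullMeasurableSet]
  simp [hm]

theorem cgf_neg_nonpos (hX : X ∈ L0Plus P) (ha : 0 ≤ a) : cgf X P (-a) ≤ 0 :=
  Real.log_nonpos (mgf_neg_pos hX ha).le (mgf_neg_le_one hX ha)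

/-- As `E[exp(-aX)]` decreases in `a`, a lower bound at the endpoint `a₁` controls the logarithm
uniformly over the support of `m`. -/
theorem norm_werm_integrand_le (hX : X ∈ L0Plus P) (h0 : 0 < a₀) (ha : a ∈ Icc a₀ a₁)
    {c : ℝ} (hc : 0 < c) (hcX : c ≤ mgf X P (-a₁)) :
    ‖1 / a * cgf X P (-a)‖ ≤ 1 / a₀ * (-Real.log c) := by
  have ha' : 0 < a := h0.trans_le ha.1
  have h1 := cgf_neg_nonpos hX ha'.le
  have h2 : Real.log c ≤ cgf X P (-a) :=
    Real.log_le_log hc (hcX.trans (mgf_neg_le_mgf_neg hX ha'.le ha.2))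
  rw [norm_mul, Real.norm_of_nonneg (by positivity), Real.norm_of_nonpos h1]
  have h3 : 1 / a ≤ 1 / a₀ := one_div_le_one_div_of_le h0 ha.1
  have h4 : 0 < 1 / a := by positivity
  exact mul_le_mul h3 (by linarith) (by linarith) (by positivity)

theorem integrable_werm (hX : X ∈ L0Plus P) (h0 : 0 < a₀) (h01 : a₀ < a₁)
    (hm : m (Icc a₀ a₁) = 1) : Integrable (fun a => 1 / a * cgf X P (-a)) m := by
  refine Integrable.of_bound (measurable_werm_integrand hX.1).aestronglyMeasurable
    (1 / a₀ * (-Real.log (mgf X P (-a₁)))) ?_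
  filter_upwards [ae_mem_Icc hm] with a ha
  exact norm_werm_integrand_le hX h0 ha (mgf_neg_pos hX (h0.trans h01).le) le_rfl

theorem werm_nonpos (hX : X ∈ L0Plus P) (h0 : 0 < a₀) (hm : m (Icc a₀ a₁) = 1) :
    werm P m X ≤ 0 := by
  refine integral_nonpos_of_ae ?_
  filter_upwards [ae_mem_Icc hm] with a ha
  have ha' : 0 < a := h0.trans_le ha.1
  exact mul_nonpos_of_nonneg_of_nonpos (by positivity) (cgf_neg_nonpos hX ha'.le)

theorem werm_anti (hX : X ∈ L0Plus P) (hY : Y ∈ L0Plus P) (h0 : 0 < a₀) (h01 : a₀ < a₁)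
    (hm : m (Icc a₀ a₁) = 1) (h : ∀ᵐ ω ∂P, X ω ≤ Y ω) : werm P m Y ≤ werm P m X := by
  refine integral_mono_ae (integrable_werm hY h0 h01 hm) (integrable_werm hX h0 h01 hm) ?_
  filter_upwards [ae_mem_Icc hm] with a ha
  have ha' : 0 < a := h0.trans_le ha.1
  exact mul_le_mul_of_nonneg_left
    (Real.log_le_log (mgf_neg_pos hY ha'.le) (mgf_neg_anti hX hY ha'.le h)) (by positivity)

/-- Hölder's inequality in normalized form: apply convexity of `exp` to the exponents `-aX - log
E[exp(-aX)]` and the analogue for `Y`, whose exponentials have mean `1`, and integrate. -/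
theorem cgf_neg_convex (hX : X ∈ L0Plus P) (hY : Y ∈ L0Plus P) {p q : ℝ} (hp : 0 ≤ p)
    (hq : 0 ≤ q) (hpq : p + q = 1) (ha : 0 ≤ a) :
    cgf (fun ω => p * X ω + q * Y ω) P (-a) ≤ p * cgf X P (-a) + q * cgf Y P (-a) := by
  have hA := mgf_neg_pos hX ha
  have hB := mgf_neg_pos hY ha
  have hZ := L0Plus_convex_comb hX hY hp hq
  have hC := mgf_neg_pos hZ ha
  set c := p * cgf X P (-a) + q * cgf Y P (-a) with hc
  have hle : ∀ ω, Real.exp (-c) * Real.exp (-a * (p * X ω + q * Y ω)) ≤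
      p * (Real.exp (-a * X ω) / mgf X P (-a)) + q * (Real.exp (-a * Y ω) / mgf Y P (-a)) := by
    intro ω
    have h := convexOn_exp.2 (mem_univ (-a * X ω - cgf X P (-a)))
      (mem_univ (-a * Y ω - cgf Y P (-a))) hp hq hpq
    simp only [smul_eq_mul, Real.exp_sub, cgf, Real.exp_log hA, Real.exp_log hB] at h
    rw [← Real.exp_add]
    rw [show -c + -a * (p * X ω + q * Y ω) = p * (-a * X ω - Real.log (mgf X P (-a))) +
      q * (-a * Y ω - Real.log (mgf Y P (-a))) by rw [hc]; simp only [cgf]; ring]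
    exact h
  have hint := integral_mono ((integrable_exp_neg_mul hZ ha).const_mul (Real.exp (-c)))
    ((((integrable_exp_neg_mul hX ha).div_const _).const_mul p).add
      (((integrable_exp_neg_mul hY ha).div_const _).const_mul q)) hle
  rw [integral_const_mul] at hint
  simp only [Pi.add_apply] at hint
  rw [integral_add (((integrable_exp_neg_mul hX ha).div_const _).const_mul p)
      (((integrable_exp_neg_mul hY ha).div_const _).const_mul q), integral_const_mul,
      integral_const_mul, integral_div, integral_div] at hint
  change Real.exp (-c) * mgf _ P (-a) ≤ p * (mgf X P (-a) / mgf X P (-a)) +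
    q * (mgf Y P (-a) / mgf Y P (-a)) at hint
  rw [div_self hA.ne', div_self hB.ne', mul_one, mul_one, hpq, Real.exp_neg,
    inv_mul_le_iff₀ (Real.exp_pos _), mul_one] at hint
  exact (Real.log_le_iff_le_exp hC).2 hint

theorem werm_convex (hX : X ∈ L0Plus P) (hY : Y ∈ L0Plus P) (h0 : 0 < a₀) (h01 : a₀ < a₁)
    (hm : m (Icc a₀ a₁) = 1) {p q : ℝ} (hp : 0 ≤ p) (hq : 0 ≤ q) (hpq : p + q = 1) :
    werm P m (fun ω => p * X ω + q * Y ω) ≤ p * werm P m X + q * werm P m Y := by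
  unfold werm
  rw [← integral_const_mul, ← integral_const_mul, ← integral_add
    ((integrable_werm hX h0 h01 hm).const_mul p) ((integrable_werm hY h0 h01 hm).const_mul q)]
  refine integral_mono_ae (integrable_werm (L0Plus_convex_comb hX hY hp hq) h0 h01 hm)
    (((integrable_werm hX h0 h01 hm).const_mul p).add
      ((integrable_werm hY h0 h01 hm).const_mul q)) ?_
  filter_upwards [ae_mem_Icc hm] with a ha
  have ha' : 0 < a := h0.trans_le ha.1
  have h := mul_le_mul_of_nonneg_left (cgf_neg_convex hX hY hp hq hpq ha'.le)
    (show 0 ≤ 1 / a by positivity)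
  linarith

/-- The risk measure is continuous along almost surely convergent sequences. -/
theorem tendsto_werm {F : ℕ → Ω → ℝ} (hF : ∀ n, F n ∈ L0Plus P) (hX : X ∈ L0Plus P)
    (h0 : 0 < a₀) (h01 : a₀ < a₁) (hm : m (Icc a₀ a₁) = 1)
    (h : ∀ᵐ ω ∂P, Tendsto (fun n => F n ω) atTop (𝓝 (X ω))) :
    Tendsto (fun n => werm P m (F n)) atTop (𝓝 (werm P m X)) := by
  have hmgf : ∀ a, 0 ≤ a → Tendsto (fun n => mgf (F n) P (-a)) atTop (𝓝 (mgf X P (-a))) := by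
    intro a ha
    refine tendsto_integral_of_dominated_convergence (fun _ => 1)
      (fun n => (integrable_exp_neg_mul (hF n) ha).aestronglyMeasurable)
      (integrable_const _) (fun n => ?_) ?_
    · filter_upwards [(hF n).2] with ω hω
      rw [Real.norm_of_nonneg (Real.exp_pos _).le]
      exact exp_neg_mul_le_one ha hω
    · filter_upwards [h] with ω hω
      exact (Real.continuous_exp.tendsto _).comp (hω.const_mul _)
  have h1 : 0 < a₁ := h0.trans h01
  have hpos := mgf_neg_pos hX h1.le
  -- Halving the limit value gives a lower bound for the moment generating functions at `-a₁` valid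
  -- for all large `n`, hence a constant dominating function.
  refine tendsto_integral_filter_of_dominated_convergence
    (fun _ => 1 / a₀ * (-Real.log (mgf X P (-a₁) / 2)))
    (Eventually.of_forall fun n => (measurable_werm_integrand (hF n).1).aestronglyMeasurable)
    ?_ (integrable_const _) ?_
  · filter_upwards [(hmgf a₁ h1.le).eventually_const_le (show mgf X P (-a₁) / 2 < _ by linarith)]
      with n hn
    filter_upwards [ae_mem_Icc hm] with a ha
    exact norm_werm_integrand_le (hF n) h0 ha (by linarith) hn
  · filter_upwards [ae_mem_Icc hm] with a ha
    have ha' : 0 < a := h0.trans_le ha.1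
    exact ((Real.continuousAt_log (mgf_neg_pos hX ha'.le).ne').tendsto.comp
      (hmgf a ha'.le)).const_mul _

theorem measurable_density (hX : Measurable X) :
    Measurable fun q : Ω × ℝ => Real.exp (-q.2 * X q.1) / mgf X P (-q.2) := by
  have h1 : Measurable fun q : Ω × ℝ => mgf X P (-q.2) :=
    (measurable_mgf_neg hX).comp measurable_snd
  have h2 : Measurable fun q : Ω × ℝ => Real.exp (-q.2 * X q.1) := by fun_prop
  exact h2.div h1

theorem density_pos (hX : X ∈ L0Plus P) (ha : 0 ≤ a) (ω : Ω) :
    0 < Real.exp (-a * X ω) / mgf X P (-a) :=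
  div_pos (Real.exp_pos _) (mgf_neg_pos hX ha)

theorem density_le (hX : X ∈ L0Plus P) (h0 : 0 < a₀) (ha : a ∈ Icc a₀ a₁) {ω : Ω}
    (hω : 0 ≤ X ω) : Real.exp (-a * X ω) / mgf X P (-a) ≤ 1 / mgf X P (-a₁) := by
  have ha' : 0 < a := h0.trans_le ha.1
  exact div_le_div₀ zero_le_one (exp_neg_mul_le_one ha'.le hω)
    (mgf_neg_pos hX (ha'.le.trans ha.2)) (mgf_neg_le_mgf_neg hX ha'.le ha.2)

theorem integrable_density_right (hX : X ∈ L0Plus P) (h0 : 0 < a₀)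
    (hm : m (Icc a₀ a₁) = 1) {ω : Ω} (hω : 0 ≤ X ω) :
    Integrable (fun a => Real.exp (-a * X ω) / mgf X P (-a)) m := by
  refine Integrable.of_bound
    ((measurable_density hX.1).comp measurable_prodMk_left).aestronglyMeasurable
    (1 / mgf X P (-a₁)) ?_
  filter_upwards [ae_mem_Icc hm] with a ha
  have ha' : 0 < a := h0.trans_le ha.1
  rw [Real.norm_of_nonneg (density_pos hX ha'.le ω).le]
  exact density_le hX h0 ha hω

theorem measurable_wermDeriv (hX : Measurable X) : Measurable (wermDeriv P m X) := by
  have h : StronglyMeasurable (Function.uncurry fun (ω : Ω) (a : ℝ) =>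
      Real.exp (-a * X ω) / mgf X P (-a)) := (measurable_density hX).stronglyMeasurable
  exact h.integral_prod_right.measurable.neg

theorem wermDeriv_neg (hX : X ∈ L0Plus P) (h0 : 0 < a₀) (hm : m (Icc a₀ a₁) = 1) {ω : Ω}
    (hω : 0 ≤ X ω) : wermDeriv P m X ω < 0 := by
  have hae : ∀ᵐ a ∂m, 0 < Real.exp (-a * X ω) / mgf X P (-a) := by
    filter_upwards [ae_mem_Icc hm] with a ha
    exact density_pos hX (h0.trans_le ha.1).le ω
  rw [wermDeriv, neg_lt_zero, integral_pos_iff_support_of_nonneg_ae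
    (hae.mono fun a ha => ha.le) (integrable_density_right hX h0 hm hω)]
  have : (Function.support fun a => Real.exp (-a * X ω) / mgf X P (-a)) =ᵐ[m] univ := by
    filter_upwards [hae] with a ha
    exact propext ⟨fun _ => trivial, fun _ => ha.ne'⟩
  rw [measure_congr this]
  simp

theorem neg_wermDeriv_le (hX : X ∈ L0Plus P) (h0 : 0 < a₀) (hm : m (Icc a₀ a₁) = 1) {ω : Ω}
    (hω : 0 ≤ X ω) : -wermDeriv P m X ω ≤ 1 / mgf X P (-a₁) := by
  rw [wermDeriv, neg_neg]
  have h : ∫ a, Real.exp (-a * X ω) / mgf X P (-a) ∂m ≤ ∫ _, 1 / mgf X P (-a₁) ∂m := by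
    refine integral_mono_ae (integrable_density_right hX h0 hm hω) (integrable_const _) ?_
    filter_upwards [ae_mem_Icc hm] with a ha
    exact density_le hX h0 ha hω
  simpa using h

theorem integrable_wermDeriv (hX : X ∈ L0Plus P) (h0 : 0 < a₀) (hm : m (Icc a₀ a₁) = 1) :
    Integrable (wermDeriv P m X) P := by
  refine Integrable.of_bound (measurable_wermDeriv hX.1).aestronglyMeasurable
    (1 / mgf X P (-a₁)) ?_
  filter_upwards [hX.2] with ω hω
  rw [Real.norm_of_nonpos (wermDeriv_neg hX h0 hm hω).le]
  exact neg_wermDeriv_le hX h0 hm hω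

/-- The kernel is nonnegative, so integrating absolute values over `a` returns exactly `|h'(X)|
|Y|`. This justifies Fubini without assuming `Y` itself integrable. -/
theorem integrable_density_mul (hX : X ∈ L0Plus P) (hY : Measurable Y) (h0 : 0 < a₀)
    (hm : m (Icc a₀ a₁) = 1) (hint : Integrable (fun ω => wermDeriv P m X ω * Y ω) P) :
    Integrable (fun q : Ω × ℝ => Real.exp (-q.2 * X q.1) / mgf X P (-q.2) * Y q.1)
      (P.prod m) := by
  have hmeas : Measurable fun q : Ω × ℝ => Real.exp (-q.2 * X q.1) / mgf X P (-q.2) * Y q.1 :=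
    (measurable_density hX.1).mul (hY.comp measurable_fst)
  rw [integrable_prod_iff hmeas.aestronglyMeasurable]
  constructor
  · filter_upwards [hX.2] with ω hω
    exact (integrable_density_right hX h0 hm hω).mul_const _
  · refine hint.norm.congr ?_
    filter_upwards [hX.2] with ω hω
    simp only [norm_mul]
    rw [integral_mul_const, wermDeriv, norm_neg]
    congr 1
    rw [Real.norm_of_nonneg]
    · refine integral_congr_ae ?_
      filter_upwards [ae_mem_Icc hm] with a ha
      rw [Real.norm_of_nonneg (density_pos hX (h0.trans_le ha.1).le ω).le]
    · refine integral_nonneg_of_ae ?_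
      filter_upwards [ae_mem_Icc hm] with a ha
      exact (density_pos hX (h0.trans_le ha.1).le ω).le

theorem integral_wermDeriv_mul (hX : X ∈ L0Plus P) (hY : Measurable Y) (h0 : 0 < a₀)
    (hm : m (Icc a₀ a₁) = 1) (hint : Integrable (fun ω => wermDeriv P m X ω * Y ω) P) :
    ∫ ω, wermDeriv P m X ω * Y ω ∂P =
      -∫ a, ∫ ω, Real.exp (-a * X ω) / mgf X P (-a) * Y ω ∂P ∂m := by
  rw [← integral_integral_swap (f := fun ω a => Real.exp (-a * X ω) / mgf X P (-a) * Y ω)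
    (integrable_density_mul hX hY h0 hm hint), ← integral_neg]
  simp_rw [integral_mul_const, wermDeriv, neg_mul]

/-- Jensen's inequality under the density `exp(-aX) / E[exp(-aX)]`: with `k` the mean of `Y - X`
under it, integrate `1 + s ≤ exp s` at `s = -a(Y - X) + ak`, whose mean is zero. -/
theorem cgf_neg_tangent (hX : X ∈ L0Plus P) (hY : Y ∈ L0Plus P) (ha : 0 < a)
    (hint : Integrable (fun ω => Real.exp (-a * X ω) / mgf X P (-a) * (Y ω - X ω)) P) :
    1 / a * cgf X P (-a) - ∫ ω, Real.exp (-a * X ω) / mgf X P (-a) * (Y ω - X ω) ∂P ≤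
      1 / a * cgf Y P (-a) := by
  have hA := mgf_neg_pos hX ha.le
  have hB := mgf_neg_pos hY ha.le
  set k := ∫ ω, Real.exp (-a * X ω) / mgf X P (-a) * (Y ω - X ω) ∂P with hk
  set A := mgf X P (-a) with hA_def
  have hle : ∀ ω, Real.exp (-a * k) * ((1 + a * k) * Real.exp (-a * X ω) -
      a * A * (Real.exp (-a * X ω) / A * (Y ω - X ω))) ≤ Real.exp (-a * Y ω) := by
    intro ω
    have h1 := Real.add_one_le_exp (-a * (Y ω - X ω) + a * k)
    have h2 : Real.exp (-a * Y ω) =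
        Real.exp (-a * k) * Real.exp (-a * X ω) * Real.exp (-a * (Y ω - X ω) + a * k) := by
      rw [← Real.exp_add, ← Real.exp_add]; congr 1; ring
    have h3 : a * A * (Real.exp (-a * X ω) / A * (Y ω - X ω)) =
        Real.exp (-a * X ω) * (a * (Y ω - X ω)) := by
      field_simp
    rw [h2, h3, mul_assoc]
    refine mul_le_mul_of_nonneg_left ?_ (Real.exp_pos _).le
    nlinarith [Real.exp_pos (-a * X ω)]
  have hi1 := (integrable_exp_neg_mul hX ha.le).const_mul (1 + a * k)
  have hi2 := hint.const_mul (a * A)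
  have h := integral_mono ((hi1.sub hi2).const_mul (Real.exp (-a * k)))
    (integrable_exp_neg_mul hY ha.le) hle
  rw [integral_const_mul] at h
  simp only [Pi.sub_apply] at h
  rw [integral_sub hi1 hi2, integral_const_mul, integral_const_mul, ← hk] at h
  change Real.exp (-a * k) * ((1 + a * k) * A - a * A * k) ≤ mgf Y P (-a) at h
  rw [show (1 + a * k) * A - a * A * k = A by ring] at h
  have hl := Real.log_le_log (mul_pos (Real.exp_pos _) hA) h
  rw [Real.log_mul (Real.exp_pos _).ne' hA.ne', Real.log_exp] at hl
  change -a * k + cgf X P (-a) ≤ cgf Y P (-a) at hl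
  have := mul_le_mul_of_nonneg_left hl (show 0 ≤ 1 / a by positivity)
  rw [mul_add, show 1 / a * (-a * k) = -k by field_simp] at this
  linarith

/-- Gradient inequality for the convex functional `werm`. -/
theorem werm_tangent (hX : X ∈ L0Plus P) (hY : Y ∈ L0Plus P) (h0 : 0 < a₀) (h01 : a₀ < a₁)
    (hm : m (Icc a₀ a₁) = 1)
    (hint : Integrable (fun ω => wermDeriv P m X ω * (Y ω - X ω)) P) :
    werm P m X + ∫ ω, wermDeriv P m X ω * (Y ω - X ω) ∂P ≤ werm P m Y := by
  have hYX : Measurable fun ω => Y ω - X ω := hY.1.sub hX.1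
  have hprod := integrable_density_mul hX hYX h0 hm hint
  rw [integral_wermDeriv_mul hX hYX h0 hm hint, ← sub_eq_add_neg]
  unfold werm
  rw [← integral_sub (integrable_werm hX h0 h01 hm) hprod.integral_prod_right]
  refine integral_mono_ae ((integrable_werm hX h0 h01 hm).sub hprod.integral_prod_right)
    (integrable_werm hY h0 h01 hm) ?_
  filter_upwards [ae_mem_Icc hm, hprod.prod_left_ae] with a ha hi
  exact cgf_neg_tangent hX hY (h0.trans_le ha.1) hi

/-- Derivative of `werm` in the direction of an indicator. -/
theorem hasDerivAt_werm_indicator (hX : X ∈ L0Plus P) (h0 : 0 < a₀) (h01 : a₀ < a₁)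
    (hm : m (Icc a₀ a₁) = 1) {A : Set Ω} (hA : MeasurableSet A) :
    HasDerivAt (fun t : ℝ => werm P m (fun ω => X ω + t * A.indicator 1 ω))
      (∫ ω in A, wermDeriv P m X ω ∂P) 0 := by
  -- Splitting over `A` and its complement gives `E[exp(-a(X + t 1_A))] = b(a) + exp(-at) c(a)`. The
  -- formula also covers negative `t`, where `X + t 1_A` may fail to be nonnegative.
  set b : ℝ → ℝ := fun a => ∫ ω in Aᶜ, Real.exp (-a * X ω) ∂P with hb
  set c : ℝ → ℝ := fun a => ∫ ω in A, Real.exp (-a * X ω) ∂P with hc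
  have hbm : Measurable b := measurable_integral_exp_neg_mul hX.1 _
  have hcm : Measurable c := measurable_integral_exp_neg_mul hX.1 _
  have hbn : ∀ a, 0 ≤ b a := fun a => integral_nonneg fun ω => (Real.exp_pos _).le
  have hcn : ∀ a, 0 ≤ c a := fun a => integral_nonneg fun ω => (Real.exp_pos _).le
  have hsum : ∀ a, 0 ≤ a → b a + c a = mgf X P (-a) := fun a ha => by
    rw [add_comm]; exact integral_add_compl hA (integrable_exp_neg_mul hX ha)
  have hpos : ∀ a, 0 ≤ a → ∀ t, 0 < b a + Real.exp (-a * t) * c a := fun a ha t => by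
    have h1 := mgf_neg_pos hX ha
    rw [← hsum a ha] at h1
    have h2 := Real.exp_pos (-a * t)
    rcases (hcn a).eq_or_lt with h | h
    · rw [← h] at h1 ⊢; linarith
    · have := mul_pos h2 h
      linarith [hbn a]
  have hmgf : ∀ a, 0 ≤ a → ∀ t, mgf (fun ω => X ω + t * A.indicator 1 ω) P (-a) =
      b a + Real.exp (-a * t) * c a := by
    intro a ha t
    have hi : Integrable (fun ω => Aᶜ.indicator (fun ω => Real.exp (-a * X ω)) ω +
        Real.exp (-a * t) * A.indicator (fun ω => Real.exp (-a * X ω)) ω) P :=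
      ((integrable_exp_neg_mul hX ha).indicator hA.compl).add
        (((integrable_exp_neg_mul hX ha).indicator hA).const_mul _)
    calc mgf (fun ω => X ω + t * A.indicator 1 ω) P (-a)
        = ∫ ω, (Aᶜ.indicator (fun ω => Real.exp (-a * X ω)) ω +
          Real.exp (-a * t) * A.indicator (fun ω => Real.exp (-a * X ω)) ω) ∂P := by
          refine integral_congr_ae (Eventually.of_forall fun ω => ?_)
          by_cases hω : ω ∈ A
          · simp only [hω, indicator_of_mem, mem_compl_iff, not_true_eq_false,
              not_false_eq_true, indicator_of_notMem, zero_add, Pi.one_apply, mul_one]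
            rw [← Real.exp_add]; congr 1; ring
          · simp [hω]
      _ = _ := by
          rw [integral_add ((integrable_exp_neg_mul hX ha).indicator hA.compl)
            (((integrable_exp_neg_mul hX ha).indicator hA).const_mul _), integral_const_mul,
            integral_indicator hA, integral_indicator hA.compl]
  have hwerm : (fun t : ℝ => werm P m (fun ω => X ω + t * A.indicator 1 ω)) =
      fun t => ∫ a, 1 / a * Real.log (b a + Real.exp (-a * t) * c a) ∂m := by
    funext t
    refine integral_congr_ae ?_
    filter_upwards [ae_mem_Icc hm] with a ha
    rw [cgf, hmgf a (h0.trans_le ha.1).le t]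
  have hderiv : ∫ ω in A, wermDeriv P m X ω ∂P =
      ∫ a, -(Real.exp (-a * 0) * c a) / (b a + Real.exp (-a * 0) * c a) ∂m := by
    have hi : Integrable (fun ω => wermDeriv P m X ω * A.indicator 1 ω) P := by
      refine ((integrable_wermDeriv hX h0 hm).indicator hA).congr
        (Eventually.of_forall fun ω => ?_)
      by_cases hω : ω ∈ A <;> simp [hω]
    have h1 : ∫ ω in A, wermDeriv P m X ω ∂P = ∫ ω, wermDeriv P m X ω * A.indicator 1 ω ∂P := by
      rw [← integral_indicator hA]
      refine integral_congr_ae (Eventually.of_forall fun ω => ?_)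
      by_cases hω : ω ∈ A <;> simp [hω]
    rw [h1, integral_wermDeriv_mul hX (measurable_one.indicator hA) h0 hm hi, ← integral_neg]
    refine integral_congr_ae ?_
    filter_upwards [ae_mem_Icc hm] with a ha
    simp only [mul_zero, Real.exp_zero, one_mul]
    rw [hsum a (h0.trans_le ha.1).le, neg_div, neg_inj]
    simp only [hc]
    rw [← integral_indicator hA, ← integral_div]
    refine integral_congr_ae (Eventually.of_forall fun ω => ?_)
    by_cases hω : ω ∈ A <;> simp [hω]
  rw [hwerm, hderiv]
  -- The `t`-derivative of the integrand is minus a quotient in `[0, 1]`, so the constant `1`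
  -- dominates it for every real `t`.
  refine (hasDerivAt_integral_of_dominated_loc_of_deriv_le (s := univ) (bound := fun _ => 1)
    (F' := fun t a => -(Real.exp (-a * t) * c a) / (b a + Real.exp (-a * t) * c a))
    univ_mem (Eventually.of_forall fun t => ?_) ?_ ?_ ?_ (integrable_const _) ?_).2
  · exact Measurable.aestronglyMeasurable (by fun_prop)
  · refine (integrable_werm hX h0 h01 hm).congr ?_
    filter_upwards [ae_mem_Icc hm] with a ha
    rw [mul_zero, Real.exp_zero, one_mul, hsum a (h0.trans_le ha.1).le, cgf]
  · exact Measurable.aestronglyMeasurable (by fun_prop)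
  · filter_upwards [ae_mem_Icc hm] with a ha t _
    have hp := hpos a (h0.trans_le ha.1).le t
    have hn : 0 ≤ Real.exp (-a * t) * c a := mul_nonneg (Real.exp_pos _).le (hcn a)
    rw [norm_div, norm_neg, Real.norm_of_nonneg hn, Real.norm_of_nonneg hp.le, div_le_one hp]
    linarith [hbn a]
  · filter_upwards [ae_mem_Icc hm] with a ha t _
    have ha' := h0.trans_le ha.1
    have hp := hpos a ha'.le t
    have hd : HasDerivAt (fun t => b a + Real.exp (-a * t) * c a)
        (Real.exp (-a * t) * (-a * 1) * c a) t :=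
      ((((hasDerivAt_id t).const_mul (-a)).exp).mul_const (c a)).const_add (b a)
    refine ((hd.log hp.ne').const_mul (1 / a)).congr_deriv ?_
    have := hp.ne'
    field_simp

end Risk

/-! ### Integrable majorants of the conjugate utility. -/

section Majorant

variable {Ω : Type*} [MeasurableSpace Ω] {P : Measure Ω}

/-- Fatou's lemma for real integrals. -/
theorem integrable_and_integral_le_of_tendsto {F : ℕ → Ω → ℝ} {G : Ω → ℝ} {C : ℕ → ℝ} {c : ℝ}
    (hF : ∀ n, Integrable (F n) P) (hpos : ∀ n, ∀ᵐ ω ∂P, 0 ≤ F n ω)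
    (hlim : ∀ᵐ ω ∂P, Tendsto (fun n => F n ω) atTop (𝓝 (G ω)))
    (hC : ∀ n, ∫ ω, F n ω ∂P ≤ C n) (hc : Tendsto C atTop (𝓝 c)) :
    Integrable G P ∧ ∫ ω, G ω ∂P ≤ c := by
  have hG0 : ∀ᵐ ω ∂P, 0 ≤ G ω := by
    filter_upwards [hlim, ae_all_iff.2 hpos] with ω h1 h2
    exact ge_of_tendsto' h1 h2
  have hGm : AEStronglyMeasurable G P :=
    aestronglyMeasurable_of_tendsto_ae atTop (fun n => (hF n).aestronglyMeasurable) hlim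
  have h1 : ∫⁻ ω, ENNReal.ofReal (G ω) ∂P ≤ ENNReal.ofReal c := by
    calc ∫⁻ ω, ENNReal.ofReal (G ω) ∂P
        = ∫⁻ ω, liminf (fun n => ENNReal.ofReal (F n ω)) atTop ∂P := by
          refine lintegral_congr_ae ?_
          filter_upwards [hlim] with ω hω
          exact ((ENNReal.continuous_ofReal.tendsto _).comp hω).liminf_eq.symm
      _ ≤ liminf (fun n => ∫⁻ ω, ENNReal.ofReal (F n ω) ∂P) atTop :=
          lintegral_liminf_le' fun n => (hF n).aemeasurable.ennreal_ofReal
      _ ≤ liminf (fun n => ENNReal.ofReal (C n)) atTop := by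
          refine liminf_le_liminf (Eventually.of_forall fun n => ?_)
          rw [← ofReal_integral_eq_lintegral_ofReal (hF n) (hpos n)]
          exact ENNReal.ofReal_le_ofReal (hC n)
      _ = ENNReal.ofReal c := ((ENNReal.continuous_ofReal.tendsto _).comp hc).liminf_eq
  have hi : Integrable G P := by
    refine ⟨hGm, ?_⟩
    rw [hasFiniteIntegral_iff_ofReal hG0]
    exact h1.trans_lt ENNReal.ofReal_lt_top
  refine ⟨hi, ?_⟩
  have hc0 : 0 ≤ c := ge_of_tendsto' hc fun n => (integral_nonneg_of_ae (hpos n)).trans (hC n)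
  rw [← ofReal_integral_eq_lintegral_ofReal hi hG0] at h1
  exact (ENNReal.ofReal_le_ofReal_iff hc0).1 h1

theorem lintegral_toENNReal_sub_eq_integral {f : Ω → EReal} {w : Ω → ℝ}
    (hf : ∀ᵐ ω ∂P, f ω = (w ω : EReal)) (hw : Integrable w P) :
    ((∫⁻ ω, (f ω).toENNReal ∂P : ENNReal) : EReal) -
      ((∫⁻ ω, (-f ω).toENNReal ∂P : ENNReal) : EReal) = ((∫ ω, w ω ∂P : ℝ) : EReal) := by
  have h1 : ∫⁻ ω, (f ω).toENNReal ∂P = ∫⁻ ω, ENNReal.ofReal (w ω) ∂P := by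
    refine lintegral_congr_ae ?_
    filter_upwards [hf] with ω hω
    simp [hω, EReal.toENNReal]
  have h2 : ∫⁻ ω, (-f ω).toENNReal ∂P = ∫⁻ ω, ENNReal.ofReal (-w ω) ∂P := by
    refine lintegral_congr_ae ?_
    filter_upwards [hf] with ω hω
    rw [hω, ← EReal.coe_neg]
    simp [EReal.toENNReal]
  have f1 : ∫⁻ ω, ENNReal.ofReal (w ω) ∂P ≠ ⊤ :=
    (hw.lintegral_lt_top).ne
  have f2 : ∫⁻ ω, ENNReal.ofReal (-w ω) ∂P ≠ ⊤ :=
    (hw.neg.lintegral_lt_top).ne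
  rw [h1, h2, integral_eq_lintegral_pos_part_sub_lintegral_neg_part hw, EReal.coe_sub,
    EReal.coe_ennreal_toReal f1, EReal.coe_ennreal_toReal f2]

theorem expectedUtility_eq {U : ℝ → ℝ} {X : Ω → ℝ} (hpos : ∀ᵐ ω ∂P, 0 < X ω)
    (hint : Integrable (fun ω => U (X ω)) P) :
    expectedUtility P U X = ((∫ ω, U (X ω) ∂P : ℝ) : EReal) := by
  refine lintegral_toENNReal_sub_eq_integral ?_ hint
  filter_upwards [hpos] with ω hω
  simp [extUtility, hω]

theorem cost_eq {ρ X : Ω → ℝ} (hpos : ∀ᵐ ω ∂P, 0 ≤ ρ ω * X ω)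
    (hint : Integrable (fun ω => ρ ω * X ω) P) :
    cost P ρ X = ENNReal.ofReal (∫ ω, ρ ω * X ω ∂P) :=
  (ofReal_integral_eq_lintegral_ofReal hint hpos).symm

/-- Under reasonable asymptotic elasticity, `U` is nonpositive or grows at most like a power. -/
theorem IsUtility.elasticity_dichotomy {U : ℝ → ℝ} (hU : IsUtility U)
    (hAE : asymptoticElasticity U < 1) :
    (∀ y, 0 < y → U y ≤ 0) ∨ ∃ y₀ c : ℝ, 0 < y₀ ∧ 0 < c ∧ c < 1 ∧
      ∀ z t, y₀ ≤ z → 1 ≤ t → U (t * z) ≤ t ^ c * U z := by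
  by_cases hneg : ∀ y, 0 < y → U y ≤ 0
  · exact Or.inl hneg
  right
  push Not at hneg
  obtain ⟨y₁, hy₁, hUy₁⟩ := hneg
  obtain ⟨c', hc', hc'1⟩ := EReal.lt_iff_exists_real_btwn.1 hAE
  have hev := eventually_lt_of_limsup_lt hc'
  obtain ⟨N, hN⟩ := eventually_atTop.1 hev
  -- Nothing bounds `c'` from below; the maximum places the exponent in `(0, 1)`.
  set c := max c' (1 / 2) with hc
  have hc1 : c < 1 := max_lt (by exact_mod_cast hc'1) (by norm_num)
  have hc0 : 0 < c := lt_of_lt_of_le (by norm_num) (le_max_right _ _)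
  set y₀ := max y₁ N with hy₀
  have hy₀pos : 0 < y₀ := hy₁.trans_le (le_max_left _ _)
  have hpos : ∀ y, y₀ ≤ y → 0 < U y := fun y hy =>
    hUy₁.trans_le (hU.mono hy₁ ((le_max_left _ _).trans hy))
  have hel : ∀ y, y₀ ≤ y → y * deriv U y ≤ c * U y := by
    intro y hy
    have h := EReal.coe_lt_coe_iff.1 (hN y ((le_max_right _ _).trans hy))
    have h2 : y * deriv U y / U y ≤ c := h.le.trans (le_max_left _ _)
    rwa [div_le_iff₀ (hpos y hy)] at h2
  have hd : ∀ y, y₀ ≤ y → HasDerivAt (fun s => U s * s ^ (-c))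
      (deriv U y * y ^ (-c) + U y * (-c * y ^ (-c - 1))) y := fun y hy =>
    (hU.hasDerivAt (hy₀pos.trans_le hy)).mul
      (Real.hasDerivAt_rpow_const (Or.inl (hy₀pos.trans_le hy).ne'))
  -- The elasticity bound `y U'(y) ≤ c U(y)` says that `U(s) s^(-c)` has nonpositive derivative.
  have hanti : AntitoneOn (fun s => U s * s ^ (-c)) (Ici y₀) := by
    refine antitoneOn_of_deriv_nonpos (convex_Ici _)
      (fun y hy => (hd y hy).continuousAt.continuousWithinAt)
      (fun y hy => (hd y (interior_subset hy)).differentiableAt.differentiableWithinAt) ?_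
    intro y hy
    have hy' : y₀ ≤ y := interior_subset hy
    have hyp : 0 < y := hy₀pos.trans_le hy'
    rw [(hd y hy').deriv, show y ^ (-c) = y ^ (-c - 1) * y by
      rw [← Real.rpow_add_one hyp.ne']; congr 1; ring]
    have h1 := hel y hy'
    have h2 := Real.rpow_pos_of_pos hyp (-c - 1)
    nlinarith
  refine ⟨y₀, c, hy₀pos, hc0, hc1, fun z t hz ht => ?_⟩
  have hzp : 0 < z := hy₀pos.trans_le hz
  have htp : 0 < t := by linarith
  have hle : z ≤ t * z := by nlinarith
  have h := hanti (show z ∈ Ici y₀ from hz) (show t * z ∈ Ici y₀ from hz.trans hle) hle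
  simp only at h
  rw [Real.mul_rpow htp.le hzp.le, Real.rpow_neg htp.le, Real.rpow_neg hzp.le] at h
  have htc := Real.rpow_pos_of_pos htp c
  have hzc := Real.rpow_pos_of_pos hzp c
  have h3 := mul_le_mul_of_nonneg_right h (mul_pos htc hzc).le
  have e1 : U (t * z) * ((t ^ c)⁻¹ * (z ^ c)⁻¹) * (t ^ c * z ^ c) = U (t * z) := by
    field_simp
  have e2 : U z * (z ^ c)⁻¹ * (t ^ c * z ^ c) = t ^ c * U z := by
    field_simp
  rwa [e1, e2] at h3

variable {ρ : Ω → ℝ} {U : ℝ → ℝ}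

/-- The conjugate `sup_y (U(y) - κ ρ y)` is dominated by an integrable random variable. -/
def HasMajorant (P : Measure Ω) (ρ : Ω → ℝ) (U : ℝ → ℝ) (κ : ℝ) : Prop :=
  ∃ v : Ω → ℝ, Integrable v P ∧ ∀ᵐ ω ∂P, ∀ y, 0 < y → U y - κ * ρ ω * y ≤ v ω

/-- For large `y`, power growth gives `U(y) ≤ t^c U(y/t) ≤ t^c (v + Bρ y/t)`. Since `c < 1`, taking
`t` large lowers the slope in `ρy` as far as desired. -/
theorem HasMajorant.rescale [IsFiniteMeasure P] (hU : IsUtility U)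
    (hAE : asymptoticElasticity U < 1)
    (hρ_pos : ∀ᵐ ω ∂P, 0 < ρ ω) {B : ℝ} (hB : HasMajorant P ρ U B) (hB0 : 0 < B) {κ : ℝ}
    (hκ : 0 < κ) : HasMajorant P ρ U κ := by
  obtain ⟨v, hv, hvB⟩ := hB
  rcases le_or_gt B κ with hle | hlt
  · refine ⟨v, hv, ?_⟩
    filter_upwards [hvB, hρ_pos] with ω h1 h2 y hy
    have h3 := h1 y hy
    have h4 := mul_le_mul_of_nonneg_right hle (mul_pos h2 hy).le
    linarith
  rcases hU.elasticity_dichotomy hAE with hneg | ⟨y₀, c, hy₀, hc0, hc1, hpow⟩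
  · refine ⟨fun _ => 0, integrable_const _, ?_⟩
    filter_upwards [hρ_pos] with ω h2 y hy
    have := hneg y hy
    have : 0 < κ * ρ ω * y := by positivity
    linarith
  -- Chosen so that `t^c B = κ t`, which makes the new slope exactly `κ`.
  set t := (B / κ) ^ (1 / (1 - c)) with ht
  have hBκ : 1 ≤ B / κ := by rw [le_div_iff₀ hκ]; linarith
  have h1c : 0 < 1 - c := by linarith
  have ht1 : 1 ≤ t := Real.one_le_rpow hBκ (by positivity)
  have htp : 0 < t := by linarith
  have htc : t ^ c * B = κ * t := by
    have h1 : t ^ (1 - c) = B / κ := by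
      rw [ht, ← Real.rpow_mul (by linarith), one_div_mul_cancel h1c.ne', Real.rpow_one]
    have h2 : t = t ^ c * t ^ (1 - c) := by
      rw [← Real.rpow_add htp]; simp
    rw [h1] at h2
    rw [h2, ← h2]
    field_simp at h2
    linarith
  refine ⟨fun ω => t ^ c * |v ω| + |U (t * y₀)|, (hv.abs.const_mul _).add (integrable_const _), ?_⟩
  filter_upwards [hvB, hρ_pos] with ω h1 h2 y hy
  have htcp := Real.rpow_pos_of_pos htp c
  have hn1 : 0 ≤ t ^ c * |v ω| := by positivity
  rcases le_or_gt y (t * y₀) with hyl | hyg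
  · have h3 := hU.mono hy hyl
    have h4 := le_abs_self (U (t * y₀))
    have : 0 < κ * ρ ω * y := by positivity
    linarith
  · have hz : y₀ ≤ y / t := by rw [le_div_iff₀ htp]; linarith
    have h3 := hpow (y / t) t hz ht1
    rw [mul_div_cancel₀ _ htp.ne'] at h3
    have h4 := h1 (y / t) (by positivity)
    have h5 := mul_le_mul_of_nonneg_left (h4.trans (le_abs_self _)) htcp.le
    have h6 : t ^ c * (U (y / t) - B * ρ ω * (y / t)) = t ^ c * U (y / t) - κ * ρ ω * y := by
      rw [mul_sub, show t ^ c * (B * ρ ω * (y / t)) = (t ^ c * B) * (ρ ω * (y / t)) by ring, htc]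
      field_simp
    have h7 := abs_nonneg (U (t * y₀))
    linarith

theorem integrable_utility_of_bounds [IsFiniteMeasure P] (hU : IsUtility U) {X : Ω → ℝ}
    (hX : Measurable X) {c C : ℝ} (hc : 0 < c) (hcX : ∀ ω, c ≤ X ω) (hCX : ∀ ω, X ω ≤ C) :
    Integrable (fun ω => U (X ω)) P := by
  refine Integrable.of_bound (hU.aestronglyMeasurable_comp hX
    (Eventually.of_forall fun ω => hc.trans_le (hcX ω))) (max |U c| |U C|)
    (Eventually.of_forall fun ω => ?_)
  rw [Real.norm_eq_abs]
  exact abs_le_max_abs_abs (hU.mono hc (hcX ω)) (hU.mono (hc.trans_le (hcX ω)) (hCX ω))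

/-- The value function is dominated by an affine function of the cost. -/
theorem exists_affine_bound [IsProbabilityMeasure P] (hρ_pos : ∀ᵐ ω ∂P, 0 < ρ ω)
    (hρ_int : Integrable ρ P)
    (hU : IsUtility U) {x : ℝ} (hx : 0 < x) (hfin : euValue P ρ U x < ⊤) :
    ∃ M B : ℝ, 0 < B ∧ ∀ X : Ω → ℝ, Measurable X → ∀ c C : ℝ, 0 < c → (∀ ω, c ≤ X ω) →
      (∀ ω, X ω ≤ C) → ∫ ω, U (X ω) ∂P ≤ M + B * ∫ ω, ρ ω * X ω ∂P := by
  obtain ⟨M', hM', -⟩ := EReal.lt_iff_exists_real_btwn.1 hfin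
  set r := ∫ ω, ρ ω ∂P with hr
  have hr0 : 0 ≤ r := integral_nonneg_of_ae (hρ_pos.mono fun ω h => h.le)
  -- A constant wealth costing at most `x/2`.
  set c₀ := x / (2 * (r + 1)) with hc₀
  have hc₀pos : 0 < c₀ := by positivity
  have hc₀r : c₀ * r ≤ x / 2 := by
    rw [hc₀, div_mul_eq_mul_div, div_le_div_iff₀ (by positivity) (by positivity)]
    nlinarith
  set M := max M' (U c₀ + 1) with hM
  have hMU : 0 < M - U c₀ := by linarith [le_max_right M' (U c₀ + 1)]
  refine ⟨M, 2 * (M - U c₀) / x, by positivity, fun X hX c C hc hcX hCX => ?_⟩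
  have hXint : Integrable (fun ω => ρ ω * X ω) P := by
    refine hρ_int.mul_bdd (c := C) hX.aestronglyMeasurable (Eventually.of_forall fun ω => ?_)
    rw [Real.norm_of_nonneg (hc.le.trans (hcX ω))]
    exact hCX ω
  set k := ∫ ω, ρ ω * X ω ∂P with hk
  have hk0 : 0 ≤ k := integral_nonneg_of_ae
    (hρ_pos.mono fun ω h => mul_nonneg h.le (hc.le.trans (hcX ω)))
  -- The weight makes `θ X` cost at most `x/2`, so the mixture with `c₀` is affordable. Concavity
  -- then bounds `θ E[U(X)]`, and dividing by `θ`, whose inverse is `1 + 2k/x`, gives a bound affine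
  -- in the cost `k`.
  set θ := x / (2 * k + x) with hθ
  have hθ0 : 0 < θ := by positivity
  have hθ1 : θ ≤ 1 := by rw [hθ, div_le_one (by positivity)]; linarith
  have hθk : θ * k ≤ x / 2 := by
    rw [hθ, div_mul_eq_mul_div, div_le_div_iff₀ (by positivity) (by positivity)]
    nlinarith
  set Y : Ω → ℝ := fun ω => θ * X ω + (1 - θ) * c₀ with hY
  have hYm : Measurable Y := (hX.const_mul θ).add_const _
  have hYpos : ∀ ω, 0 < Y ω := fun ω => by
    have := mul_pos hθ0 (hc.trans_le (hcX ω))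
    have : 0 ≤ (1 - θ) * c₀ := mul_nonneg (by linarith) hc₀pos.le
    simp only [hY]; linarith
  have hYc : ∀ ω, θ * c + (1 - θ) * c₀ ≤ Y ω := fun ω => by
    have := mul_le_mul_of_nonneg_left (hcX ω) hθ0.le
    simp only [hY]; linarith
  have hYC : ∀ ω, Y ω ≤ θ * C + (1 - θ) * c₀ := fun ω => by
    have := mul_le_mul_of_nonneg_left (hCX ω) hθ0.le
    simp only [hY]; linarith
  have hUY : Integrable (fun ω => U (Y ω)) P :=
    integrable_utility_of_bounds hU hYm (by nlinarith [mul_pos hθ0 hc]) hYc hYC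
  have hUX : Integrable (fun ω => U (X ω)) P := integrable_utility_of_bounds hU hX hc hcX hCX
  have hYeq : (fun ω => ρ ω * Y ω) = fun ω => θ * (ρ ω * X ω) + (1 - θ) * c₀ * ρ ω := by
    funext ω; simp only [hY]; ring
  have hYint : Integrable (fun ω => ρ ω * Y ω) P := by
    rw [hYeq]; exact (hXint.const_mul _).add (hρ_int.const_mul _)
  have hcost : ∫ ω, ρ ω * Y ω ∂P ≤ x := by
    rw [hYeq, integral_add (hXint.const_mul _) (hρ_int.const_mul _), integral_const_mul,
      integral_const_mul, ← hk, ← hr]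
    have : (1 - θ) * c₀ * r ≤ x / 2 := by
      have := mul_nonneg (mul_nonneg hθ0.le hc₀pos.le) hr0
      nlinarith
    linarith
  have hYaff : Y ∈ affordable P ρ x := by
    refine ⟨⟨hYm, Eventually.of_forall fun ω => (hYpos ω).le⟩, ?_⟩
    rw [cost_eq (hρ_pos.mono fun ω h => mul_nonneg h.le (hYpos ω).le) hYint]
    exact ENNReal.ofReal_le_ofReal hcost
  have hEU : ∫ ω, U (Y ω) ∂P ≤ M := by
    have h1 : expectedUtility P U Y ≤ euValue P ρ U x :=
      le_iSup₂ (f := fun X (_ : X ∈ affordable P ρ x) => expectedUtility P U X) Y hYaff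
    rw [expectedUtility_eq (Eventually.of_forall hYpos) hUY] at h1
    have h2 := EReal.coe_lt_coe_iff.1 (h1.trans_lt hM')
    exact h2.le.trans (le_max_left _ _)
  have hconc : θ * (∫ ω, U (X ω) ∂P) + (1 - θ) * U c₀ ≤ ∫ ω, U (Y ω) ∂P := by
    have h1 : ∫ ω, (θ * U (X ω) + (1 - θ) * U c₀) ∂P ≤ ∫ ω, U (Y ω) ∂P := by
      refine integral_mono ((hUX.const_mul _).add (integrable_const _)) hUY fun ω => ?_
      exact hU.strictConcaveOn.concaveOn.2 (hc.trans_le (hcX ω)) hc₀pos hθ0.le (by linarith)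
        (by ring)
    rw [integral_add (hUX.const_mul _) (integrable_const _), integral_const_mul] at h1
    simpa using h1
  have h3 : θ * (∫ ω, U (X ω) ∂P) ≤ θ * U c₀ + (M - U c₀) := by linarith
  have h4 : θ * (M + 2 * (M - U c₀) / x * k) = θ * U c₀ + (M - U c₀) := by
    rw [hθ]; field_simp; ring
  rw [← h4] at h3
  exact le_of_mul_le_mul_left h3 hθ0

/-- The affine bound `E[U(X)] ≤ M + B E[ρX]` bounds `E[U(X) - BρX]` over bounded wealths. Applied to
truncations of the pointwise maximizer `I(Bρ)`, it makes the pointwise supremum integrable. -/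
theorem exists_hasMajorant [IsProbabilityMeasure P] (hρ_meas : Measurable ρ)
    (hρ_pos : ∀ᵐ ω ∂P, 0 < ρ ω) (hρ_int : Integrable ρ P)
    (hU : IsUtility U) {x : ℝ} (hx : 0 < x) (hfin : euValue P ρ U x < ⊤) :
    ∃ B, 0 < B ∧ HasMajorant P ρ U B := by
  classical
  obtain ⟨M, B, hB, hMB⟩ := exists_affine_bound hρ_pos hρ_int hU hx hfin
  refine ⟨B, hB, ?_⟩
  set J : Ω → ℝ := fun ω => invMarginal U (B * ρ ω) with hJ
  have hJm : Measurable J := hU.measurable_invMarginal.comp (hρ_meas.const_mul B)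
  have hJpos : ∀ᵐ ω ∂P, 0 < J ω :=
    hρ_pos.mono fun ω h => hU.invMarginal_pos (mul_pos hB h)
  -- On `E n` the maximizer lies between positive constants; replacing it by `1` elsewhere gives a
  -- wealth to which the affine bound applies.
  set E : ℕ → Set Ω := fun n => J ⁻¹' Icc (1 / ((n : ℝ) + 1)) (n + 1) with hE
  have hEm : ∀ n, MeasurableSet (E n) := fun n => hJm measurableSet_Icc
  -- The excess of the supremum over the value at `y = 1`. It is nonnegative, so Fatou's lemma
  -- applies to its restrictions to `E n`.
  set W : Ω → ℝ := fun ω => (U (J ω) - B * ρ ω * J ω) - (U 1 - B * ρ ω * 1) with hW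
  have hW0 : ∀ᵐ ω ∂P, 0 ≤ W ω := by
    filter_upwards [hρ_pos] with ω h
    have := hU.sub_mul_le (mul_pos hB h) one_pos
    simp only [hW, hJ]
    linarith
  set X : ℕ → Ω → ℝ := fun n => (E n).piecewise J (fun _ => 1) with hX
  have hXm : ∀ n, Measurable (X n) := fun n => hJm.piecewise (hEm n) measurable_const
  have hXl : ∀ (n : ℕ) ω, 1 / ((n : ℝ) + 1) ≤ X n ω := fun n ω => by
    by_cases h : ω ∈ E n
    · simp only [hX, piecewise_eq_of_mem _ _ _ h]; exact h.1
    · simp only [hX, piecewise_eq_of_notMem _ _ _ h]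
      rw [div_le_one (by positivity)]
      linarith [n.cast_nonneg (α := ℝ)]
  have hXu : ∀ (n : ℕ) ω, X n ω ≤ (n : ℝ) + 1 := fun n ω => by
    by_cases h : ω ∈ E n
    · simp only [hX, piecewise_eq_of_mem _ _ _ h]; exact h.2
    · simp only [hX, piecewise_eq_of_notMem _ _ _ h]
      linarith [n.cast_nonneg (α := ℝ)]
  have hXp : ∀ n ω, 0 < X n ω := fun n ω => lt_of_lt_of_le (by positivity) (hXl n ω)
  have hUX : ∀ n, Integrable (fun ω => U (X n ω)) P := fun n =>
    integrable_utility_of_bounds hU (hXm n) (by positivity) (hXl n) (hXu n)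
  have hρX : ∀ n, Integrable (fun ω => ρ ω * X n ω) P := fun n => by
    refine hρ_int.mul_bdd (c := n + 1) (hXm n).aestronglyMeasurable
      (Eventually.of_forall fun ω => ?_)
    rw [Real.norm_of_nonneg (hXp n ω).le]
    exact hXu n ω
  have hind : ∀ n ω, (E n).indicator W ω =
      U (X n ω) - B * (ρ ω * X n ω) - (U 1 - B * ρ ω) := fun n ω => by
    by_cases h : ω ∈ E n
    · rw [indicator_of_mem h]; simp only [hX, hW, piecewise_eq_of_mem _ _ _ h]; ring
    · rw [indicator_of_notMem h]; simp only [hX, piecewise_eq_of_notMem _ _ _ h]; ring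
  have i1 : ∀ n, Integrable (fun ω => U (X n ω) - B * (ρ ω * X n ω)) P := fun n =>
    (hUX n).sub ((hρX n).const_mul B)
  have i2 : Integrable (fun ω => U 1 - B * ρ ω) P :=
    (integrable_const _).sub (hρ_int.const_mul B)
  have hWint := integrable_and_integral_le_of_tendsto (P := P)
    (F := fun n => (E n).indicator W) (G := W)
    (C := fun _ => M - ∫ ω, (U 1 - B * ρ ω) ∂P)
    (fun n => ((i1 n).sub i2).congr (Eventually.of_forall fun ω => (hind n ω).symm))
    (fun n => hW0.mono fun ω h => indicator_apply_nonneg fun _ => h) ?_ (fun n => ?_)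
    tendsto_const_nhds
  · refine ⟨fun ω => W ω + (U 1 - B * ρ ω), hWint.1.add i2, ?_⟩
    filter_upwards [hρ_pos] with ω h y hy
    have := hU.sub_mul_le (mul_pos hB h) hy
    simp only [hW, hJ]
    linarith
  · filter_upwards [hJpos] with ω hω
    refine tendsto_const_nhds.congr' ?_
    obtain ⟨N, hN⟩ := exists_nat_ge (max (J ω) (1 / J ω))
    filter_upwards [eventually_ge_atTop N] with n hn
    have hn' : (N : ℝ) ≤ n := by exact_mod_cast hn
    rw [indicator_of_mem]
    refine ⟨?_, ?_⟩
    · rw [div_le_iff₀ (by positivity)]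
      have h1 : 1 / J ω ≤ n := ((le_max_right _ _).trans hN).trans hn'
      rw [div_le_iff₀ hω] at h1
      linarith
    · have h1 : J ω ≤ n := ((le_max_left _ _).trans hN).trans hn'
      linarith
  · simp_rw [hind]
    rw [integral_sub (i1 n) i2, integral_sub (hUX n) ((hρX n).const_mul B), integral_const_mul]
    have := hMB (X n) (hXm n) _ _ (by positivity) (hXl n) (hXu n)
    linarith

theorem hasMajorant [IsProbabilityMeasure P] (hρ_meas : Measurable ρ)
    (hρ_pos : ∀ᵐ ω ∂P, 0 < ρ ω) (hρ_int : Integrable ρ P)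
    (hU : IsUtility U) (hAE : asymptoticElasticity U < 1)
    (hfin : ∃ x : ℝ, 0 < x ∧ euValue P ρ U x < ⊤) {κ : ℝ} (hκ : 0 < κ) :
    HasMajorant P ρ U κ := by
  obtain ⟨x, hx, hfx⟩ := hfin
  obtain ⟨B, hB, hBm⟩ := exists_hasMajorant hρ_meas hρ_pos hρ_int hU hx hfx
  exact hBm.rescale hU hAE hρ_pos hB hκ

end Majorant

/-! ### Admissible wealths, strict feasibility and Lagrange multipliers. -/

section Multipliers

variable {Ω : Type*} [MeasurableSpace Ω]

/-- Positive terminal wealths with finite cost and integrable utility. -/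
structure Admissible (P : Measure Ω) (ρ : Ω → ℝ) (U : ℝ → ℝ) (X : Ω → ℝ) : Prop where
  measurable : Measurable X
  pos : ∀ᵐ ω ∂P, 0 < X ω
  integrable_utility : Integrable (fun ω => U (X ω)) P
  integrable_cost : Integrable (fun ω => ρ ω * X ω) P

variable {P : Measure Ω} {ρ : Ω → ℝ} {U : ℝ → ℝ} {X Y : Ω → ℝ} {m : Measure ℝ} {a₀ a₁ x γ : ℝ}

theorem Admissible.mem_L0Plus (hX : Admissible P ρ U X) : X ∈ L0Plus P :=
  ⟨hX.measurable, hX.pos.mono fun _ h => h.le⟩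

/-- Finite cost and the majorant bound `U(X)` above, so only an integrable minorant has to be
supplied. -/
theorem Admissible.of_le (hU : IsUtility U) {κ : ℝ} (hmaj : HasMajorant P ρ U κ)
    (hX : Measurable X) (hpos : ∀ᵐ ω ∂P, 0 < X ω) (hc : Integrable (fun ω => ρ ω * X ω) P)
    {g : Ω → ℝ} (hg : Integrable g P) (hgU : ∀ᵐ ω ∂P, g ω ≤ U (X ω)) : Admissible P ρ U X := by
  obtain ⟨v, hv, hvle⟩ := hmaj
  refine ⟨hX, hpos, ?_, hc⟩
  refine integrable_of_le_of_le (hU.aestronglyMeasurable_comp hX hpos) hgU ?_ hg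
    (hv.add (hc.const_mul κ))
  filter_upwards [hvle, hpos] with ω h1 h2
  have := h1 _ h2
  simp only [Pi.add_apply]
  linarith

theorem Admissible.convex_comb (hU : IsUtility U) {κ : ℝ} (hmaj : HasMajorant P ρ U κ)
    (hX : Admissible P ρ U X) (hY : Admissible P ρ U Y) {p q : ℝ} (hp : 0 ≤ p) (hq : 0 ≤ q)
    (hpq : p + q = 1) : Admissible P ρ U (fun ω => p * X ω + q * Y ω) := by
  refine Admissible.of_le hU hmaj (L0Plus_convex_comb hX.mem_L0Plus hY.mem_L0Plus hp hq).1 ?_ ?_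
    ((hX.integrable_utility.const_mul p).add (hY.integrable_utility.const_mul q)) ?_
  · filter_upwards [hX.pos, hY.pos] with ω h1 h2
    exact (convex_Ioi (0 : ℝ)) h1 h2 hp hq hpq
  · refine ((hX.integrable_cost.const_mul p).add (hY.integrable_cost.const_mul q)).congr
      (Eventually.of_forall fun ω => ?_)
    simp only [Pi.add_apply]; ring
  · filter_upwards [hX.pos, hY.pos] with ω h1 h2
    exact hU.strictConcaveOn.concaveOn.2 h1 h2 hp hq hpq

theorem Admissible.integral_convex_comb (hU : IsUtility U) {κ : ℝ} (hmaj : HasMajorant P ρ U κ)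
    (hX : Admissible P ρ U X) (hY : Admissible P ρ U Y) {p q : ℝ} (hp : 0 ≤ p) (hq : 0 ≤ q)
    (hpq : p + q = 1) :
    p * (∫ ω, U (X ω) ∂P) + q * (∫ ω, U (Y ω) ∂P) ≤ ∫ ω, U (p * X ω + q * Y ω) ∂P := by
  rw [← integral_const_mul, ← integral_const_mul, ← integral_add
    (hX.integrable_utility.const_mul p) (hY.integrable_utility.const_mul q)]
  refine integral_mono_ae ((hX.integrable_utility.const_mul p).add
    (hY.integrable_utility.const_mul q))
    (hX.convex_comb hU hmaj hY hp hq hpq).integrable_utility ?_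
  filter_upwards [hX.pos, hY.pos] with ω h1 h2
  exact hU.strictConcaveOn.concaveOn.2 h1 h2 hp hq hpq

theorem integral_cost_convex_comb (hX : Integrable (fun ω => ρ ω * X ω) P)
    (hY : Integrable (fun ω => ρ ω * Y ω) P) (p q : ℝ) :
    ∫ ω, ρ ω * (p * X ω + q * Y ω) ∂P = p * (∫ ω, ρ ω * X ω ∂P) + q * ∫ ω, ρ ω * Y ω ∂P := by
  rw [← integral_const_mul, ← integral_const_mul, ← integral_add (hX.const_mul p)
    (hY.const_mul q)]
  refine integral_congr_ae (Eventually.of_forall fun ω => ?_)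
  simp only; ring

theorem integrable_cost_of_affordable (hρ_meas : Measurable ρ) (hρ_pos : ∀ᵐ ω ∂P, 0 < ρ ω)
    (hx : 0 < x) (hX : X ∈ affordable P ρ x) :
    Integrable (fun ω => ρ ω * X ω) P ∧ ∫ ω, ρ ω * X ω ∂P ≤ x := by
  have hnn : ∀ᵐ ω ∂P, 0 ≤ ρ ω * X ω := by
    filter_upwards [hρ_pos, hX.1.2] with ω h1 h2
    positivity
  have hi : Integrable (fun ω => ρ ω * X ω) P := by
    refine ⟨(hρ_meas.mul hX.1.1).aestronglyMeasurable, ?_⟩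
    rw [hasFiniteIntegral_iff_ofReal hnn]
    exact hX.2.trans_lt ENNReal.ofReal_lt_top
  refine ⟨hi, ?_⟩
  have h := hX.2
  rw [cost_eq hnn hi] at h
  exact (ENNReal.ofReal_le_ofReal_iff hx.le).1 h

/-- Slater's condition. -/
theorem exists_slater [IsProbabilityMeasure P] [IsProbabilityMeasure m] (hρ_meas : Measurable ρ)
    (hρ_pos : ∀ᵐ ω ∂P, 0 < ρ ω) (hρ_int : Integrable ρ P)
    (hU : IsUtility U) {κ : ℝ} (hmaj : HasMajorant P ρ U κ)
    (h0 : 0 < a₀) (h01 : a₀ < a₁) (hm : m (Icc a₀ a₁) = 1) (hx : 0 < x)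
    (hγ : minRisk P m ρ x < (γ : EReal)) :
    ∃ X, Admissible P ρ U X ∧ ∫ ω, ρ ω * X ω ∂P < x ∧ werm P m X < γ := by
  obtain ⟨X, hX, hXγ⟩ : ∃ X, X ∈ affordable P ρ x ∧ (werm P m X : EReal) < γ := by
    simpa only [minRisk, iInf_lt_iff, exists_prop] using hγ
  have hXγ : werm P m X < γ := EReal.coe_lt_coe_iff.1 hXγ
  obtain ⟨hXi, hXx⟩ := integrable_cost_of_affordable hρ_meas hρ_pos hx hX
  set r := ∫ ω, ρ ω ∂P with hr
  have hr0 : 0 ≤ r := integral_nonneg_of_ae (hρ_pos.mono fun ω h => h.le)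
  set c := x / (2 * (r + 1)) with hc
  have hcpos : 0 < c := by positivity
  have hcr : r * c ≤ x / 2 := by
    rw [hc, mul_div_assoc', div_le_div_iff₀ (by positivity) (by positivity)]
    nlinarith
  have hconst : (fun _ : Ω => c) ∈ L0Plus P :=
    ⟨measurable_const, Eventually.of_forall fun _ => hcpos.le⟩
  set d := werm P m (fun _ : Ω => c) - werm P m X with hd
  -- Small enough that convexity keeps the risk of the mixture below `γ`; the second entry gives `ε
  -- d < γ - h(X)`.
  set ε := min (1 / 2) ((γ - werm P m X) / (2 * (|d| + 1))) with hε
  have hε0 : 0 < ε := lt_min (by norm_num) (div_pos (by linarith) (by positivity))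
  have hε1 : ε ≤ 1 / 2 := min_le_left _ _
  have hεd : ε * d < γ - werm P m X := by
    have h1 : ε * (2 * (|d| + 1)) ≤ γ - werm P m X := by
      rw [← le_div_iff₀ (by positivity)]; exact min_le_right _ _
    nlinarith [le_abs_self d, abs_nonneg d]
  have hZ := L0Plus_convex_comb hX.1 hconst (p := 1 - ε) (q := ε) (by linarith) hε0.le
  have hle : ∀ᵐ ω ∂P, ε * c ≤ (1 - ε) * X ω + ε * c := by
    filter_upwards [hX.1.2] with ω h
    have : 0 ≤ (1 - ε) * X ω := mul_nonneg (by linarith) h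
    linarith
  have hεc := mul_pos hε0 hcpos
  have hci : Integrable (fun ω => ρ ω * c) P := hρ_int.mul_const c
  refine ⟨fun ω => (1 - ε) * X ω + ε * c, Admissible.of_le hU hmaj hZ.1
    (hle.mono fun ω h => hεc.trans_le h) ?_ (integrable_const (U (ε * c)))
    (hle.mono fun ω h => hU.mono hεc h), ?_, ?_⟩
  · refine ((hXi.const_mul (1 - ε)).add (hci.const_mul ε)).congr
      (Eventually.of_forall fun ω => ?_)
    simp only [Pi.add_apply]; ring
  · rw [integral_cost_convex_comb hXi hci, integral_mul_const]
    nlinarith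
  · refine (werm_convex hX.1 hconst h0 h01 hm (p := 1 - ε) (q := ε) (by linarith) hε0.le
      (by ring)).trans_lt ?_
    simp only [hd] at hεd
    linarith

/-- Lagrange multipliers for the cost and the risk constraint. -/
theorem exists_multipliers [IsProbabilityMeasure P] [IsProbabilityMeasure m]
    (hU : IsUtility U) {κ : ℝ} (hmaj : HasMajorant P ρ U κ)
    (h0 : 0 < a₀) (h01 : a₀ < a₁) (hm : m (Icc a₀ a₁) = 1)
    (hslater : ∃ X, Admissible P ρ U X ∧ ∫ ω, ρ ω * X ω ∂P < x ∧ werm P m X < γ) {V : ℝ}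
    (hV : ∀ X, Admissible P ρ U X → ∫ ω, ρ ω * X ω ∂P ≤ x → werm P m X ≤ γ →
      ∫ ω, U (X ω) ∂P ≤ V) :
    ∃ lam mu : ℝ, 0 ≤ lam ∧ 0 ≤ mu ∧ ∀ X, Admissible P ρ U X →
      (∫ ω, U (X ω) ∂P) - lam * (∫ ω, ρ ω * X ω ∂P - x) - mu * (werm P m X - γ) ≤ V := by
  -- Strict inequalities make the set of dominated triples open, and `(V, x, γ)` lies outside it
  -- because `V` bounds the utility of feasible wealths.
  set S : Set (ℝ × ℝ × ℝ) := {q | ∃ X, Admissible P ρ U X ∧ q.1 < ∫ ω, U (X ω) ∂P ∧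
    ∫ ω, ρ ω * X ω ∂P < q.2.1 ∧ werm P m X < q.2.2} with hS
  have hSo : IsOpen S := by
    have : S = ⋃ X ∈ {X | Admissible P ρ U X}, {q : ℝ × ℝ × ℝ | q.1 < ∫ ω, U (X ω) ∂P ∧
        ∫ ω, ρ ω * X ω ∂P < q.2.1 ∧ werm P m X < q.2.2} := by
      ext q; simp only [hS, mem_ofPred_eq, mem_iUnion, exists_prop]
    rw [this]
    refine isOpen_biUnion fun X _ => ?_
    exact (isOpen_lt continuous_fst continuous_const).inter
      ((isOpen_lt continuous_const (continuous_fst.comp continuous_snd)).inter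
        (isOpen_lt continuous_const (continuous_snd.comp continuous_snd)))
  have hlt : ∀ {p q s t s' t' : ℝ}, 0 ≤ p → 0 ≤ q → p + q = 1 → s < t → s' < t' →
      p * s + q * s' < p * t + q * t' := by
    intro p q s t s' t' hp hq hpq h1 h2
    rcases hp.eq_or_lt with h | h
    · subst h
      have : q = 1 := by linarith
      subst this; linarith
    · nlinarith [mul_pos h (sub_pos.2 h1), mul_nonneg hq (sub_pos.2 h2).le]
  have hSc : Convex ℝ S := by
    rintro ⟨r, s, t⟩ ⟨X, hX, h1, h2, h3⟩ ⟨r', s', t'⟩ ⟨Y, hY, h1', h2', h3'⟩ p q hp hq hpq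
    simp only at h1 h2 h3 h1' h2' h3'
    refine ⟨fun ω => p * X ω + q * Y ω, hX.convex_comb hU hmaj hY hp hq hpq, ?_, ?_, ?_⟩
    · exact (hlt hp hq hpq h1 h1').trans_le (hX.integral_convex_comb hU hmaj hY hp hq hpq)
    · rw [integral_cost_convex_comb hX.integrable_cost hY.integrable_cost]
      exact hlt hp hq hpq h2 h2'
    · exact (werm_convex hX.mem_L0Plus hY.mem_L0Plus h0 h01 hm hp hq hpq).trans_lt
        (hlt hp hq hpq h3 h3')
  have hnot : (V, x, γ) ∉ S := by
    rintro ⟨X, hX, h1, h2, h3⟩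
    exact absurd (hV X hX h2.le h3.le) (not_le.2 h1)
  obtain ⟨f, hf⟩ := geometric_hahn_banach_open_point hSc hSo hnot
  set α := f (1, 0, 0) with hα
  set β := f (0, 1, 0) with hβ
  set δ := f (0, 0, 1) with hδ
  have hfe : ∀ r s t : ℝ, f (r, s, t) = α * r + β * s + δ * t := by
    intro r s t
    have : ((r, s, t) : ℝ × ℝ × ℝ) =
        r • ((1, 0, 0) : ℝ × ℝ × ℝ) + s • ((0, 1, 0) : ℝ × ℝ × ℝ) +
          t • ((0, 0, 1) : ℝ × ℝ × ℝ) := by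
      simp
    rw [this, map_add, map_add, map_smul, map_smul, map_smul]
    simp only [smul_eq_mul, hα, hβ, hδ]
    ring
  have hfS : ∀ r s t X, Admissible P ρ U X → r < ∫ ω, U (X ω) ∂P → ∫ ω, ρ ω * X ω ∂P < s →
      werm P m X < t → α * r + β * s + δ * t < α * V + β * x + δ * γ := by
    intro r s t X hX h1 h2 h3
    rw [← hfe, ← hfe]
    exact hf _ ⟨X, hX, h1, h2, h3⟩
  obtain ⟨Z, hZ, hZx, hZγ⟩ := hslater
  set r₀ := min (∫ ω, U (Z ω) ∂P) V - 1 with hr₀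
  have hr₀Z : r₀ < ∫ ω, U (Z ω) ∂P := by linarith [min_le_left (∫ ω, U (Z ω) ∂P) V]
  have hr₀V : r₀ < V := by linarith [min_le_right (∫ ω, U (Z ω) ∂P) V]
  -- At the strictly feasible `Z` the cost and risk coordinates may be set to `x` and `γ`; they
  -- cancel and leave `α r₀ < α V` with `r₀ < V`.
  have hαpos : 0 < α := by
    have h := hfS r₀ x γ Z hZ hr₀Z hZx hZγ
    by_contra! hn
    nlinarith
  -- The set is unbounded upwards in the cost coordinate; for `β > 0` this increment would violate
  -- the separation. The sign of `δ` is found in the same way.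
  have hβ0 : β ≤ 0 := by
    by_contra! hn
    have hd : 0 < α * (V - r₀) / β := div_pos (mul_pos hαpos (by linarith)) hn
    have h := hfS r₀ (x + α * (V - r₀) / β) γ Z hZ hr₀Z (by linarith) hZγ
    rw [mul_add, mul_div_cancel₀ _ hn.ne'] at h
    linarith
  have hδ0 : δ ≤ 0 := by
    by_contra! hn
    have hd : 0 < α * (V - r₀) / δ := div_pos (mul_pos hαpos (by linarith)) hn
    have h := hfS r₀ x (γ + α * (V - r₀) / δ) Z hZ hr₀Z hZx (by linarith)
    rw [mul_add, mul_div_cancel₀ _ hn.ne'] at h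
    linarith
  refine ⟨-β / α, -δ / α, div_nonneg (by linarith) hαpos.le, div_nonneg (by linarith) hαpos.le,
    fun X hX => ?_⟩
  have hK : 0 < α - β - δ := by linarith
  have key : α * (∫ ω, U (X ω) ∂P) + β * (∫ ω, ρ ω * X ω ∂P) + δ * werm P m X ≤
      α * V + β * x + δ * γ := by
    -- Shifting all three coordinates by `ε / (α - β - δ)` moves the triple of `X` into the open set
    -- and changes the functional by exactly `ε`.
    refine le_of_forall_pos_le_add fun ε hε => ?_
    have hε' : 0 < ε / (α - β - δ) := div_pos hε hK
    have h := hfS (∫ ω, U (X ω) ∂P - ε / (α - β - δ))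
      (∫ ω, ρ ω * X ω ∂P + ε / (α - β - δ)) (werm P m X + ε / (α - β - δ)) X hX
      (by linarith) (by linarith) (by linarith)
    have he : (α - β - δ) * (ε / (α - β - δ)) = ε := mul_div_cancel₀ _ hK.ne'
    nlinarith
  have h2 : (∫ ω, U (X ω) ∂P) - -β / α * (∫ ω, ρ ω * X ω ∂P - x) - -δ / α * (werm P m X - γ) =
      (α * (∫ ω, U (X ω) ∂P) + β * (∫ ω, ρ ω * X ω ∂P) + δ * werm P m X - β * x - δ * γ) / α := by
    field_simp
    ring
  rw [h2, div_le_iff₀ hαpos]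
  linarith

end Multipliers

/-! ### Existence of the optimizer by strict concavity and Fatou's lemma. -/

section Existence

variable {Ω : Type*} [MeasurableSpace Ω] {P : Measure Ω} {ρ : Ω → ℝ} {U : ℝ → ℝ} {X : Ω → ℝ}
  {m : Measure ℝ} {a₀ a₁ x γ : ℝ}

/-- A sequence that is Cauchy in `L¹` has an almost surely convergent subsequence. -/
theorem exists_subseq_tendsto_ae_of_cauchy {G : ℕ → Ω → ℝ} (hG : ∀ n, Integrable (G n) P)
    (hC : ∀ ε > 0, ∃ N, ∀ n ≥ N, ∀ k ≥ N, ∫ ω, |G n ω - G k ω| ∂P < ε) :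
    ∃ (φ : ℕ → ℕ) (W : Ω → ℝ), StrictMono φ ∧ Measurable W ∧
      ∀ᵐ ω ∂P, Tendsto (fun n => G (φ n) ω) atTop (𝓝 (W ω)) := by
  have hcs : CauchySeq fun n => (hG n).toL1 (G n) := by
    rw [Metric.cauchySeq_iff]
    intro ε hε
    obtain ⟨N, hN⟩ := hC ε hε
    refine ⟨N, fun n hn k hk => ?_⟩
    rw [dist_eq_norm, ← Integrable.toL1_sub _ _ (hG n) (hG k), L1.norm_of_fun_eq_integral_norm]
    exact hN n hn k hk
  obtain ⟨g, hg⟩ := cauchySeq_tendsto_of_complete hcs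
  obtain ⟨φ, hφ, hlim⟩ := (tendstoInMeasure_of_tendsto_Lp hg).exists_seq_tendsto_ae
  refine ⟨φ, g, hφ, (Lp.stronglyMeasurable g).measurable, ?_⟩
  have hcoe : ∀ᵐ ω ∂P, ∀ n, ((hG n).toL1 (G n)) ω = G n ω :=
    ae_all_iff.2 fun n => (hG n).coeFn_toL1
  filter_upwards [hlim, hcoe] with ω h1 h2
  simpa only [h2] using h1

/-- Where `exp(-F n)` and `exp(-F k)` differ by at least `ε/2`, the midpoint gap is at least `δ`.
Small mean gaps thus make `exp(-F n)` Cauchy in `L¹`, and the budget prevents the limit from being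
`exp(-∞) = 0`. -/
theorem exists_subseq_tendsto_ae [IsProbabilityMeasure P] (hU : IsUtility U)
    (hρ_meas : Measurable ρ) (hρ_pos : ∀ᵐ ω ∂P, 0 < ρ ω) {F : ℕ → Ω → ℝ} (hF : ∀ n, Admissible P ρ U (F n))
    (hcost : ∀ n, ∫ ω, ρ ω * F n ω ∂P ≤ x) {e : ℕ → ℝ} (he : Tendsto e atTop (𝓝 0))
    (hgap_int : ∀ n k, Integrable
      (fun ω => U ((F n ω + F k ω) / 2) - (U (F n ω) + U (F k ω)) / 2) P)
    (hgap : ∀ n k, ∫ ω, (U ((F n ω + F k ω) / 2) - (U (F n ω) + U (F k ω)) / 2) ∂P ≤ e n + e k) :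
    ∃ (φ : ℕ → ℕ) (X : Ω → ℝ), StrictMono φ ∧ Measurable X ∧ (∀ ω, 0 ≤ X ω) ∧
      ∀ᵐ ω ∂P, Tendsto (fun n => F (φ n) ω) atTop (𝓝 (X ω)) := by
  have hGi : ∀ n, Integrable (fun ω => Real.exp (-F n ω)) P := fun n => by
    simpa using integrable_exp_neg_mul (hF n).mem_L0Plus zero_le_one
  obtain ⟨φ, W, hφ, hW, hlim⟩ := exists_subseq_tendsto_ae_of_cauchy hGi (by
    intro ε hε
    obtain ⟨δ, hδ, hδgap⟩ := hU.exists_midpoint_gap (half_pos hε)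
    have hsmall : 0 < ε * δ / 4 := by positivity
    obtain ⟨N, hN⟩ := eventually_atTop.1 (he.eventually_lt_const hsmall)
    refine ⟨N, fun n hn k hk => ?_⟩
    have hle : ∀ᵐ ω ∂P, |Real.exp (-F n ω) - Real.exp (-F k ω)| ≤ ε / 2 + 1 / δ *
        (U ((F n ω + F k ω) / 2) - (U (F n ω) + U (F k ω)) / 2) := by
      filter_upwards [(hF n).pos, (hF k).pos] with ω h1 h2
      have hg0 := hU.midpoint_le h1 h2
      rcases le_or_gt (ε / 2) |Real.exp (-F n ω) - Real.exp (-F k ω)| with h | h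
      · have hg := hδgap _ _ h1 h2 h
        have h3 : |Real.exp (-F n ω) - Real.exp (-F k ω)| ≤ 1 := by
          have e1 : Real.exp (-F n ω) ≤ 1 := Real.exp_le_one_iff.2 (by linarith)
          have e2 : Real.exp (-F k ω) ≤ 1 := Real.exp_le_one_iff.2 (by linarith)
          rw [abs_le]
          constructor <;> linarith [Real.exp_pos (-F n ω), Real.exp_pos (-F k ω)]
        have h4 : 1 ≤ 1 / δ * (U ((F n ω + F k ω) / 2) - (U (F n ω) + U (F k ω)) / 2) := by
          rw [one_div_mul_eq_div, le_div_iff₀ hδ]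
          linarith
        linarith
      · have : 0 ≤ 1 / δ * (U ((F n ω + F k ω) / 2) - (U (F n ω) + U (F k ω)) / 2) :=
          mul_nonneg (by positivity) (by linarith)
        linarith
    have h1 := integral_mono_ae ((hGi n).sub (hGi k)).abs
      ((integrable_const (ε / 2)).add ((hgap_int n k).const_mul (1 / δ))) hle
    simp only [Pi.add_apply] at h1
    rw [integral_add (integrable_const (ε / 2)) ((hgap_int n k).const_mul (1 / δ)),
      integral_const_mul] at h1
    simp only [integral_const, probReal_univ, smul_eq_mul, one_mul] at h1
    have h2 : 1 / δ * (∫ ω, (U ((F n ω + F k ω) / 2) - (U (F n ω) + U (F k ω)) / 2) ∂P) <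
        ε / 2 := by
      rw [one_div_mul_eq_div, div_lt_iff₀ hδ]
      linarith [hgap n k, hN n hn, hN k hk]
    exact h1.trans_lt (by linarith))
  refine ⟨φ, fun ω => max 0 (-Real.log (W ω)), hφ,
    measurable_const.max (Real.measurable_log.comp hW).neg, fun ω => le_max_left _ _, ?_⟩
  have hfat : ∫⁻ ω, liminf (fun n => ENNReal.ofReal (ρ ω * F (φ n) ω)) atTop ∂P < ⊤ := by
    calc ∫⁻ ω, liminf (fun n => ENNReal.ofReal (ρ ω * F (φ n) ω)) atTop ∂P
        ≤ liminf (fun n => ∫⁻ ω, ENNReal.ofReal (ρ ω * F (φ n) ω) ∂P) atTop :=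
          lintegral_liminf_le' fun n => (hF _).integrable_cost.aemeasurable.ennreal_ofReal
      _ ≤ liminf (fun _ : ℕ => ENNReal.ofReal x) atTop := by
          refine liminf_le_liminf (Eventually.of_forall fun n => ?_)
          rw [← ofReal_integral_eq_lintegral_ofReal (hF _).integrable_cost]
          · exact ENNReal.ofReal_le_ofReal (hcost _)
          · filter_upwards [hρ_pos, (hF (φ n)).pos] with ω h1 h2
            exact (mul_pos h1 h2).le
      _ < ⊤ := by simp
  have hfin : ∀ᵐ ω ∂P, liminf (fun n => ENNReal.ofReal (ρ ω * F (φ n) ω)) atTop < ⊤ :=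
    ae_lt_top (Measurable.liminf fun n =>
    (hρ_meas.mul (hF (φ n)).measurable).ennreal_ofReal) hfat.ne
  have hpos : ∀ᵐ ω ∂P, ∀ n, 0 < F n ω := ae_all_iff.2 fun n => (hF n).pos
  filter_upwards [hlim, hfin, hpos, hρ_pos] with ω h1 h2 h3 h4
  have hW0 : 0 ≤ W ω := ge_of_tendsto' h1 fun n => (Real.exp_pos _).le
  -- `W ω = 0` would mean `F (φ n) ω → ∞`, contradicting the finite liminf of `ρ F` supplied by
  -- Fatou's lemma.
  have hWpos : 0 < W ω := by
    refine hW0.lt_of_ne fun h => ?_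
    rw [← h] at h1
    have ht : Tendsto (fun n => F (φ n) ω) atTop atTop :=
      tendsto_neg_atBot_iff.1 (Real.tendsto_exp_comp_nhds_zero.1 h1)
    have h5 := (ENNReal.tendsto_ofReal_nhds_top.2 (ht.const_mul_atTop h4)).liminf_eq
    rw [h5] at h2
    exact lt_irrefl _ h2
  have h6 : Tendsto (fun n => F (φ n) ω) atTop (𝓝 (-Real.log (W ω))) := by
    have := ((Real.continuousAt_log hWpos.ne').tendsto.comp h1).neg
    refine this.congr fun n => ?_
    simp
  rwa [max_eq_right (ge_of_tendsto' h6 fun n => (h3 _).le)]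

/-- The Inada condition at `0` forces limits of nearly optimal wealths to be positive. -/
theorem ae_pos_of_tendsto [IsProbabilityMeasure P] [IsProbabilityMeasure m] (hU : IsUtility U)
    (hρ_meas : Measurable ρ) (hρ_pos : ∀ᵐ ω ∂P, 0 < ρ ω)
    (hmaj : ∀ κ > 0, HasMajorant P ρ U κ)
    (h0 : 0 < a₀) (h01 : a₀ < a₁) (hm : m (Icc a₀ a₁) = 1) {lam mu V : ℝ} (hlam : 0 ≤ lam)
    (hmu : 0 ≤ mu)
    (hL : ∀ X, Admissible P ρ U X →
      (∫ ω, U (X ω) ∂P) - lam * (∫ ω, ρ ω * X ω ∂P - x) - mu * (werm P m X - γ) ≤ V)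
    {F : ℕ → Ω → ℝ} (hF : ∀ n, Admissible P ρ U (F n))
    (hcost : ∀ n, ∫ ω, ρ ω * F n ω ∂P ≤ x) (hrisk : ∀ n, werm P m (F n) ≤ γ)
    (hV : Tendsto (fun n => ∫ ω, U (F n ω) ∂P) atTop (𝓝 V)) (hXm : Measurable X)
    (hX0 : ∀ ω, 0 ≤ X ω) (hlim : ∀ᵐ ω ∂P, Tendsto (fun n => F n ω) atTop (𝓝 (X ω))) :
    ∀ᵐ ω ∂P, 0 < X ω := by
  have key : ∀ N : ℕ, ∀ᵐ ω ∂P, ρ ω ≤ N → 0 < X ω := by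
    intro N
    -- Where `F n ≤ ε = y/2` and `ρ ≤ N`, adding `ε` raises utility by at least `ε(λN + 1)` and
    -- costs at most `ελN` in the Lagrangian, while risk does not increase. Hence `ε P(A n) ≤ V -
    -- E[U(F n)]`, which tends to `0`.
    obtain ⟨y, hyN, hy0⟩ := ((hU.inada_zero.eventually_ge_atTop (lam * N + 1)).and
      self_mem_nhdsWithin).exists
    have hy0 : 0 < y := hy0
    set ε := y / 2 with hε
    have hε0 : 0 < ε := by positivity
    set A : ℕ → Set Ω := fun n => {ω | F n ω ≤ ε} ∩ {ω | ρ ω ≤ N} with hA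
    have hAm : ∀ n, MeasurableSet (A n) := fun n =>
      (measurableSet_le (hF n).measurable measurable_const).inter
        (measurableSet_le hρ_meas measurable_const)
    set I : ℕ → Ω → ℝ := fun n => (A n).indicator 1 with hI
    have hIm : ∀ n, Measurable (I n) := fun n => measurable_one.indicator (hAm n)
    have hIint : ∀ n, Integrable (I n) P := fun n => (integrable_const (1 : ℝ)).indicator (hAm n)
    have hI0 : ∀ n ω, 0 ≤ I n ω := fun n ω => indicator_nonneg (fun _ _ => zero_le_one) ω
    have hGge : ∀ n ω, F n ω ≤ F n ω + ε * I n ω := fun n ω => by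
      have := mul_nonneg hε0.le (hI0 n ω)
      linarith
    have hρI : ∀ n ω, ρ ω * I n ω ≤ N * I n ω := fun n ω => by
      by_cases h : ω ∈ A n
      · exact mul_le_mul_of_nonneg_right h.2 (hI0 n ω)
      · simp [hI, h]
    have hρI_int : ∀ n, Integrable (fun ω => ρ ω * I n ω) P := fun n => by
      refine ((hIint n).const_mul (N : ℝ)).mono' (hρ_meas.mul (hIm n)).aestronglyMeasurable ?_
      filter_upwards [hρ_pos] with ω h
      rw [Real.norm_of_nonneg (mul_nonneg h.le (hI0 n ω))]
      exact hρI n ω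
    have hGm : ∀ n, Measurable fun ω => F n ω + ε * I n ω := fun n =>
      (hF n).measurable.add ((hIm n).const_mul ε)
    have hG : ∀ n, Admissible P ρ U (fun ω => F n ω + ε * I n ω) := fun n => by
      refine Admissible.of_le hU (hmaj 1 one_pos) (hGm n) ?_ ?_ (hF n).integrable_utility ?_
      · filter_upwards [(hF n).pos] with ω h
        exact h.trans_le (hGge n ω)
      · refine ((hF n).integrable_cost.add ((hρI_int n).const_mul ε)).congr
          (Eventually.of_forall fun ω => ?_)
        simp only [Pi.add_apply]; ring
      · filter_upwards [(hF n).pos] with ω h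
        exact hU.mono h (hGge n ω)
    have hPA : ∀ n, ∫ ω, I n ω ∂P ≤ (V - ∫ ω, U (F n ω) ∂P) / ε := by
      intro n
      have h1 := hL _ (hG n)
      have h2 : werm P m (fun ω => F n ω + ε * I n ω) ≤ werm P m (F n) :=
        werm_anti (hF n).mem_L0Plus (hG n).mem_L0Plus h0 h01 hm
          (Eventually.of_forall (hGge n))
      have h3 : ∫ ω, ρ ω * (F n ω + ε * I n ω) ∂P ≤
          ∫ ω, ρ ω * F n ω ∂P + ε * N * ∫ ω, I n ω ∂P := by
        rw [← integral_const_mul, ← integral_add (hF n).integrable_cost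
          ((hIint n).const_mul _)]
        refine integral_mono (hG n).integrable_cost
          ((hF n).integrable_cost.add ((hIint n).const_mul _)) fun ω => ?_
        have := mul_le_mul_of_nonneg_left (hρI n ω) hε0.le
        simp only
        linarith
      have h4 : ∫ ω, U (F n ω) ∂P + ε * (lam * N + 1) * ∫ ω, I n ω ∂P ≤
          ∫ ω, U (F n ω + ε * I n ω) ∂P := by
        rw [← integral_const_mul, ← integral_add (hF n).integrable_utility
          ((hIint n).const_mul _)]
        refine integral_mono_ae ((hF n).integrable_utility.add ((hIint n).const_mul _))
          (hG n).integrable_utility ?_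
        filter_upwards [(hF n).pos] with ω h
        by_cases hω : ω ∈ A n
        · have hF_le : F n ω ≤ ε := hω.1
          simp only [hI, indicator_of_mem hω, Pi.one_apply, mul_one]
          have h5 := hU.le_tangent (show 0 < F n ω + ε by linarith) h
          have h6 : deriv U y ≤ deriv U (F n ω + ε) :=
            hU.deriv_strictAntiOn.antitoneOn (show 0 < F n ω + ε by linarith) hy0
              (by rw [hε] at hF_le ⊢; linarith)
          have h7 := mul_le_mul_of_nonneg_left (hyN.trans h6) hε0.le
          linarith
        · simp [hI, hω]
      rw [le_div_iff₀ hε0]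
      have h5 := mul_le_mul_of_nonneg_left h3 hlam
      have h6 := mul_le_mul_of_nonneg_left (h2.trans (hrisk n)) hmu
      have h7 := mul_le_mul_of_nonneg_left (hcost n) hlam
      linarith
    set B : Set Ω := {ω | X ω = 0} ∩ {ω | ρ ω ≤ N} with hB
    have hBm : MeasurableSet B := (hXm (measurableSet_singleton 0)).inter
      (measurableSet_le hρ_meas measurable_const)
    have hfat := integrable_and_integral_le_of_tendsto (P := P)
      (F := fun n => B.indicator (I n)) (G := B.indicator 1)
      (C := fun n => (V - ∫ ω, U (F n ω) ∂P) / ε) (c := 0)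
      (fun n => (hIint n).indicator hBm)
      (fun n => Eventually.of_forall fun ω => indicator_nonneg (fun ω _ => hI0 n ω) ω) ?_
      (fun n => ?_) ?_
    · have h1 : P.real B ≤ 0 := by
        rw [← integral_indicator_one hBm]; exact hfat.2
      have h2 : P B = 0 := (measureReal_eq_zero_iff).1 (le_antisymm h1 measureReal_nonneg)
      have h3 : ∀ᵐ ω ∂P, ω ∉ B := measure_eq_zero_iff_ae_notMem.1 h2
      filter_upwards [h3] with ω hω hρN
      exact (hX0 ω).lt_of_ne fun h => hω ⟨h.symm, hρN⟩
    · filter_upwards [hlim] with ω hω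
      by_cases hωB : ω ∈ B
      · refine tendsto_const_nhds.congr' ?_
        have hX : X ω = 0 := hωB.1
        rw [hX] at hω
        filter_upwards [hω.eventually_le_const hε0] with n hn
        have : ω ∈ A n := ⟨hn, hωB.2⟩
        simp [hI, hωB, this]
      · simp [hωB]
    · refine (integral_mono ((hIint n).indicator hBm) (hIint n) fun ω => ?_).trans (hPA n)
      exact indicator_le_self' (fun _ _ => hI0 n ω) ω
    · have := (tendsto_const_nhds (x := V)).sub hV
      simpa using this.div_const ε
  filter_upwards [ae_all_iff.2 key] with ω hω
  obtain ⟨N, hN⟩ := exists_nat_ge (ρ ω)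
  exact hω N hN

/-- Existence of a maximizer under the cost and the risk constraint, with Lagrange multipliers. -/
theorem exists_lagrange_optimizer [IsProbabilityMeasure P] [IsProbabilityMeasure m]
    (hU : IsUtility U) (hρ_meas : Measurable ρ) (hρ_pos : ∀ᵐ ω ∂P, 0 < ρ ω)
    (hmaj : ∀ κ > 0, HasMajorant P ρ U κ)
    (h0 : 0 < a₀) (h01 : a₀ < a₁) (hm : m (Icc a₀ a₁) = 1)
    (hslater : ∃ X, Admissible P ρ U X ∧ ∫ ω, ρ ω * X ω ∂P < x ∧ werm P m X < γ) :
    ∃ (X : Ω → ℝ) (lam mu : ℝ), Admissible P ρ U X ∧ ∫ ω, ρ ω * X ω ∂P ≤ x ∧ werm P m X ≤ γ ∧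
      0 ≤ lam ∧ 0 ≤ mu ∧ lam * (∫ ω, ρ ω * X ω ∂P - x) = 0 ∧ mu * (werm P m X - γ) = 0 ∧
      ∀ Y, Admissible P ρ U Y →
        (∫ ω, U (Y ω) ∂P) - lam * (∫ ω, ρ ω * Y ω ∂P) - mu * werm P m Y ≤
          (∫ ω, U (X ω) ∂P) - lam * (∫ ω, ρ ω * X ω ∂P) - mu * werm P m X := by
  set T : Set ℝ := {r | ∃ X, (Admissible P ρ U X ∧ ∫ ω, ρ ω * X ω ∂P ≤ x ∧ werm P m X ≤ γ) ∧
    ∫ ω, U (X ω) ∂P = r} with hT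
  have hTne : T.Nonempty := by
    obtain ⟨Z, hZ, h1, h2⟩ := hslater
    exact ⟨_, Z, ⟨hZ, h1.le, h2.le⟩, rfl⟩
  have hTb : BddAbove T := by
    obtain ⟨v, hv, hvle⟩ := hmaj 1 one_pos
    refine ⟨∫ ω, v ω ∂P + x, ?_⟩
    rintro r ⟨X, ⟨hX, hXx, -⟩, rfl⟩
    have h1 : ∫ ω, U (X ω) ∂P ≤ ∫ ω, (v ω + ρ ω * X ω) ∂P := by
      refine integral_mono_ae hX.integrable_utility (hv.add hX.integrable_cost) ?_
      filter_upwards [hvle, hX.pos] with ω h1 h2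
      have := h1 _ h2
      linarith
    rw [integral_add hv hX.integrable_cost] at h1
    linarith
  set V := sSup T with hVdef
  have hVle : ∀ X, Admissible P ρ U X → ∫ ω, ρ ω * X ω ∂P ≤ x → werm P m X ≤ γ →
      ∫ ω, U (X ω) ∂P ≤ V := fun X hX h1 h2 => le_csSup hTb ⟨X, ⟨hX, h1, h2⟩, rfl⟩
  obtain ⟨lam, mu, hlam, hmu, hL⟩ :=
    exists_multipliers hU (hmaj 1 one_pos) h0 h01 hm hslater hVle
  obtain ⟨u, -, hu, huT⟩ := exists_seq_tendsto_sSup hTne hTb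
  choose F₀ hF₀ hF₀u using huT
  have hgap_eq : ∀ n k : ℕ, ∀ ω, (F₀ n ω + F₀ k ω) / 2 = 1 / 2 * F₀ n ω + 1 / 2 * F₀ k ω :=
    fun n k ω => by ring
  have hmid : ∀ n k, Admissible P ρ U (fun ω => (F₀ n ω + F₀ k ω) / 2) := fun n k => by
    simp only [hgap_eq]
    exact (hF₀ n).1.convex_comb hU (hmaj 1 one_pos) (hF₀ k).1 (by norm_num) (by norm_num)
      (by norm_num)
  have hmidV : ∀ n k, ∫ ω, U ((F₀ n ω + F₀ k ω) / 2) ∂P ≤ V := fun n k => by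
    refine hVle _ (hmid n k) ?_ ?_
    · simp only [hgap_eq]
      rw [integral_cost_convex_comb (hF₀ n).1.integrable_cost (hF₀ k).1.integrable_cost]
      linarith [(hF₀ n).2.1, (hF₀ k).2.1]
    · simp only [hgap_eq]
      have := werm_convex (hF₀ n).1.mem_L0Plus (hF₀ k).1.mem_L0Plus h0 h01 hm
        (p := 1 / 2) (q := 1 / 2) (by norm_num) (by norm_num) (by norm_num)
      linarith [(hF₀ n).2.2, (hF₀ k).2.2]
  have havg : ∀ n k, Integrable (fun ω => (U (F₀ n ω) + U (F₀ k ω)) / 2) P := fun n k =>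
    ((hF₀ n).1.integrable_utility.add (hF₀ k).1.integrable_utility).div_const 2
  -- A midpoint of feasible wealths has utility at most `V`, so the mean midpoint gap is at most the
  -- sum of these half-deficits.
  have hu' : Tendsto (fun n => (V - u n) / 2) atTop (𝓝 0) := by
    have := ((tendsto_const_nhds (x := V)).sub hu).div_const 2
    rwa [← hVdef, sub_self, zero_div] at this
  obtain ⟨φ, X, hφ, hXm, hX0, hlim⟩ := exists_subseq_tendsto_ae (x := x) hU hρ_meas hρ_pos
    (fun n => (hF₀ n).1) (fun n => (hF₀ n).2.1) hu'
    (fun n k => (hmid n k).integrable_utility.sub (havg n k)) (fun n k => by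
      rw [integral_sub (hmid n k).integrable_utility (havg n k), integral_div,
        integral_add (hF₀ n).1.integrable_utility (hF₀ k).1.integrable_utility, hF₀u, hF₀u]
      linarith [hmidV n k])
  have hF : ∀ n, Admissible P ρ U (F₀ (φ n)) := fun n => (hF₀ _).1
  have hJ : Tendsto (fun n => ∫ ω, U (F₀ (φ n) ω) ∂P) atTop (𝓝 V) := by
    simp only [hF₀u]
    exact hu.comp hφ.tendsto_atTop
  have hXpos := ae_pos_of_tendsto hU hρ_meas hρ_pos hmaj h0 h01 hm hlam hmu hL hF
    (fun n => (hF₀ _).2.1) (fun n => (hF₀ _).2.2) hJ hXm hX0 hlim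
  obtain ⟨hXc, hXx⟩ := integrable_and_integral_le_of_tendsto (P := P)
    (F := fun n ω => ρ ω * F₀ (φ n) ω) (G := fun ω => ρ ω * X ω) (C := fun _ => x)
    (fun n => (hF n).integrable_cost)
    (fun n => by
      filter_upwards [hρ_pos, (hF n).pos] with ω h1 h2
      positivity)
    (hlim.mono fun ω h => h.const_mul _) (fun n => (hF₀ _).2.1) tendsto_const_nhds
  have hXγ : werm P m X ≤ γ := le_of_tendsto'
    (tendsto_werm (fun n => (hF n).mem_L0Plus) ⟨hXm, Eventually.of_forall hX0⟩ h0 h01 hm hlim)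
    fun n => (hF₀ _).2.2
  -- Fatou's lemma for the nonnegative `v + κρF - U(F)` bounds the loss of utility in the limit by
  -- `κx`. Having a majorant for every `κ > 0` allows the loss to be sent to zero.
  have hXU : ∀ κ > 0, Integrable (fun ω => U (X ω)) P ∧ V ≤ ∫ ω, U (X ω) ∂P + κ * x := by
    intro κ hκ
    obtain ⟨v, hv, hvle⟩ := hmaj κ hκ
    have hsum : ∀ Z : Ω → ℝ, Integrable (fun ω => ρ ω * Z ω) P →
        Integrable (fun ω => v ω + κ * (ρ ω * Z ω)) P := fun Z hZ => hv.add (hZ.const_mul κ)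
    have h1 := integrable_and_integral_le_of_tendsto (P := P)
      (F := fun n ω => v ω + κ * (ρ ω * F₀ (φ n) ω) - U (F₀ (φ n) ω))
      (G := fun ω => v ω + κ * (ρ ω * X ω) - U (X ω))
      (C := fun n => ∫ ω, v ω ∂P + κ * x - ∫ ω, U (F₀ (φ n) ω) ∂P)
      (fun n => (hsum _ (hF n).integrable_cost).sub (hF n).integrable_utility)
      (fun n => by
        filter_upwards [hvle, (hF n).pos] with ω h1 h2
        have := h1 _ h2
        linarith)
      (by
        filter_upwards [hlim, hXpos] with ω h1 h2
        exact ((h1.const_mul _).const_mul _).const_add _ |>.sub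
          ((hU.hasDerivAt h2).continuousAt.tendsto.comp h1))
      (fun n => by
        rw [integral_sub (hsum _ (hF n).integrable_cost) (hF n).integrable_utility,
          integral_add hv ((hF n).integrable_cost.const_mul κ), integral_const_mul]
        have := mul_le_mul_of_nonneg_left (hF₀ (φ n)).2.1 hκ.le
        linarith)
      (tendsto_const_nhds.sub hJ)
    have h2 := hsum X hXc
    have h3 : Integrable (fun ω => U (X ω)) P := by
      refine (h2.sub h1.1).congr (Eventually.of_forall fun ω => ?_)
      simp only [Pi.sub_apply]; ring
    refine ⟨h3, ?_⟩
    have h4 := h1.2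
    rw [integral_sub h2 h3, integral_add hv (hXc.const_mul κ), integral_const_mul] at h4
    have h5 : 0 ≤ ∫ ω, ρ ω * X ω ∂P := integral_nonneg_of_ae (by
      filter_upwards [hρ_pos] with ω h
      exact mul_nonneg h.le (hX0 ω))
    have := mul_nonneg hκ.le h5
    linarith
  have hX : Admissible P ρ U X := ⟨hXm, hXpos, (hXU 1 one_pos).1, hXc⟩
  have hVX : V ≤ ∫ ω, U (X ω) ∂P := by
    refine le_of_forall_pos_le_add fun ε hε => ?_
    have hd : 0 < |x| + 1 := by positivity
    have h1 := (hXU (ε / (|x| + 1)) (by positivity)).2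
    have h2 : ε / (|x| + 1) * x ≤ ε := by
      rw [div_mul_eq_mul_div, div_le_iff₀ hd]
      nlinarith [le_abs_self x]
    linarith
  have hLX := hL X hX
  -- At `X` the Lagrangian is at most `V ≤ E[U(X)]`, so the two nonnegative slack terms have sum at
  -- most zero and both vanish.
  have hs1 := mul_nonneg hlam (sub_nonneg.2 hXx)
  have hs2 := mul_nonneg hmu (sub_nonneg.2 hXγ)
  refine ⟨X, lam, mu, hX, hXx, hXγ, hlam, hmu, by linarith, by linarith, fun Y hY => ?_⟩
  have := hL Y hY
  linarith

end Existence

/-! ### Necessity and sufficiency of the first-order condition. -/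

section Optimality

theorem mul_indicator_one {Ω : Type*} (A : Set Ω) (f : Ω → ℝ) (ω : Ω) :
    f ω * A.indicator 1 ω = A.indicator f ω := by
  by_cases h : ω ∈ A <;> simp [h]

variable {Ω : Type*} [MeasurableSpace Ω] {P : Measure Ω} {ρ : Ω → ℝ} {U : ℝ → ℝ} {X Y : Ω → ℝ}
  {m : Measure ℝ} {a₀ a₁ x γ lam mu : ℝ}

/-- Since `X ≥ ε` on `A`, perturbations with `t ≥ -ε/2` stay above `ε/2` there. Small `t` of both
signs are thus allowed, which yields equality in the first-order condition. -/
theorem Admissible.add_indicator [IsProbabilityMeasure P] (hU : IsUtility U) {κ : ℝ}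
    (hmaj : HasMajorant P ρ U κ) (hρ_int : Integrable ρ P) (hX : Admissible P ρ U X) {ε t : ℝ}
    (hε : 0 < ε) {A : Set Ω} (hA : MeasurableSet A) (hAX : ∀ ω ∈ A, ε ≤ X ω)
    (ht : -(ε / 2) ≤ t) : Admissible P ρ U (fun ω => X ω + t * A.indicator 1 ω) := by
  have hI : Measurable (A.indicator (1 : Ω → ℝ)) := measurable_one.indicator hA
  refine Admissible.of_le hU hmaj (hX.measurable.add (hI.const_mul t)) ?_ ?_
    (g := fun ω => -(|U (X ω)| + |U (ε / 2)|))
    (hX.integrable_utility.abs.add (integrable_const _)).neg ?_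
  · filter_upwards [hX.pos] with ω h
    by_cases hω : ω ∈ A
    · simp only [indicator_of_mem hω, Pi.one_apply, mul_one]
      linarith [hAX ω hω]
    · simpa [hω] using h
  · refine (hX.integrable_cost.add ((hρ_int.indicator hA).const_mul t)).congr
      (Eventually.of_forall fun ω => ?_)
    simp only [Pi.add_apply, ← mul_indicator_one A ρ ω]
    ring
  · refine Eventually.of_forall fun ω => ?_
    by_cases hω : ω ∈ A
    · simp only [indicator_of_mem hω, Pi.one_apply, mul_one]
      have := hU.mono (half_pos hε) (show ε / 2 ≤ X ω + t by linarith [hAX ω hω])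
      linarith [neg_abs_le (U (ε / 2)), abs_nonneg (U (X ω))]
    · simp only [indicator_of_notMem hω, mul_zero, add_zero]
      linarith [neg_abs_le (U (X ω)), abs_nonneg (U (ε / 2))]

theorem hasDerivAt_integral_utility [IsProbabilityMeasure P] (hU : IsUtility U) {κ : ℝ}
    (hmaj : HasMajorant P ρ U κ) (hρ_int : Integrable ρ P) (hX : Admissible P ρ U X) {ε : ℝ}
    (hε : 0 < ε) {A : Set Ω} (hA : MeasurableSet A) (hAX : ∀ ω ∈ A, ε ≤ X ω) :
    HasDerivAt (fun t : ℝ => ∫ ω, U (X ω + t * A.indicator 1 ω) ∂P)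
      (∫ ω in A, deriv U (X ω) ∂P) 0 := by
  have hI : Measurable (A.indicator (1 : Ω → ℝ)) := measurable_one.indicator hA
  have hball : ∀ t ∈ Metric.ball (0 : ℝ) (ε / 2), -(ε / 2) ≤ t := fun t ht => by
    rw [Metric.mem_ball, dist_zero_right, Real.norm_eq_abs, abs_lt] at ht
    exact ht.1.le
  have h := hasDerivAt_integral_of_dominated_loc_of_deriv_le (μ := P) (x₀ := (0 : ℝ))
    (s := Metric.ball 0 (ε / 2)) (F := fun t ω => U (X ω + t * A.indicator 1 ω))
    (F' := fun t ω => deriv U (X ω + t * A.indicator 1 ω) * A.indicator 1 ω)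
    (bound := fun _ => deriv U (ε / 2)) (Metric.ball_mem_nhds _ (half_pos hε)) ?_ ?_ ?_ ?_
    (integrable_const _) ?_
  · refine h.2.congr_deriv ?_
    rw [← integral_indicator hA]
    refine integral_congr_ae (Eventually.of_forall fun ω => ?_)
    simp only [zero_mul, add_zero]
    exact mul_indicator_one A (fun ω => deriv U (X ω)) ω
  · filter_upwards [Metric.ball_mem_nhds (0 : ℝ) (half_pos hε)] with t ht
    exact (hX.add_indicator hU hmaj hρ_int hε hA hAX
      (hball t ht)).integrable_utility.aestronglyMeasurable
  · simpa using hX.integrable_utility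
  · exact (((measurable_deriv U).comp (hX.measurable.add (hI.const_mul 0))).mul
      hI).aestronglyMeasurable
  · refine Eventually.of_forall fun ω t ht => ?_
    have h2 := hball t ht
    by_cases hω : ω ∈ A
    · simp only [indicator_of_mem hω, Pi.one_apply, mul_one]
      have h3 : ε / 2 ≤ X ω + t := by linarith [hAX ω hω]
      have h4 : 0 < X ω + t := by linarith
      rw [Real.norm_of_nonneg (hU.deriv_pos h4).le]
      exact hU.deriv_strictAntiOn.antitoneOn (half_pos hε) h4 h3
    · simpa [hω] using (hU.deriv_pos (half_pos hε)).le
  · refine Eventually.of_forall fun ω t ht => ?_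
    have h2 := hball t ht
    by_cases hω : ω ∈ A
    · simp only [indicator_of_mem hω, Pi.one_apply, mul_one]
      exact (hU.hasDerivAt (by linarith [hAX ω hω])).comp_const_add _ _
    · simpa [hω] using hasDerivAt_const t (U (X ω))

/-- A maximizer of the Lagrangian satisfies the first-order condition. -/
theorem firstOrderCondition_of_lagrange [IsProbabilityMeasure P] [IsProbabilityMeasure m]
    (hU : IsUtility U) {κ : ℝ} (hmaj : HasMajorant P ρ U κ) (hρ_int : Integrable ρ P)
    (h0 : 0 < a₀) (h01 : a₀ < a₁) (hm : m (Icc a₀ a₁) = 1) (hX : Admissible P ρ U X)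
    (hopt : ∀ Y, Admissible P ρ U Y →
      (∫ ω, U (Y ω) ∂P) - lam * (∫ ω, ρ ω * Y ω ∂P) - mu * werm P m Y ≤
        (∫ ω, U (X ω) ∂P) - lam * (∫ ω, ρ ω * X ω ∂P) - mu * werm P m X) :
    FirstOrderCondition P m ρ U lam mu X := by
  set Ψ : Ω → ℝ := fun ω => deriv U (X ω) - mu * wermDeriv P m X ω - lam * ρ ω with hΨ
  have hwd := integrable_wermDeriv hX.mem_L0Plus h0 hm
  have key : ∀ n : ℕ, ∀ᵐ ω ∂P, 1 / ((n : ℝ) + 1) ≤ X ω → Ψ ω = 0 := by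
    intro n
    set ε : ℝ := 1 / ((n : ℝ) + 1) with hε_def
    have hε : 0 < ε := by positivity
    set B : Set Ω := {ω | ε ≤ X ω} with hB
    have hBm : MeasurableSet B := measurableSet_le measurable_const hX.measurable
    have hdB : IntegrableOn (fun ω => deriv U (X ω)) B P := by
      refine Integrable.of_bound ((measurable_deriv U).comp hX.measurable).aestronglyMeasurable
        (deriv U ε) ?_
      filter_upwards [ae_restrict_mem hBm] with ω hω
      have hω' : ε ≤ X ω := hω
      rw [Real.norm_of_nonneg (hU.deriv_pos (hε.trans_le hω')).le]
      exact hU.deriv_strictAntiOn.antitoneOn hε (hε.trans_le hω') hω'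
    have hi1 : IntegrableOn (fun ω => deriv U (X ω) - mu * wermDeriv P m X ω) B P :=
      hdB.sub (hwd.const_mul mu).integrableOn
    have hΨi : IntegrableOn Ψ B P := hi1.sub (hρ_int.const_mul lam).integrableOn
    have hzero : Ψ =ᵐ[P.restrict B] 0 := by
      -- The integral of `Ψ` over `s ∩ B` is the derivative at `t = 0` of the Lagrangian in the
      -- direction `1_(s ∩ B)`, and `t = 0` is a local maximum.
      refine Integrable.ae_eq_zero_of_forall_setIntegral_eq_zero hΨi fun s hs _ => ?_
      rw [Measure.restrict_restrict hs]
      have hA : MeasurableSet (s ∩ B) := hs.inter hBm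
      have hAX : ∀ ω ∈ s ∩ B, ε ≤ X ω := fun ω hω => hω.2
      have d1 := hasDerivAt_integral_utility hU hmaj hρ_int hX hε hA hAX
      have d2 := hasDerivAt_werm_indicator hX.mem_L0Plus h0 h01 hm hA
      have hcost : (fun t : ℝ => ∫ ω, ρ ω * (X ω + t * (s ∩ B).indicator 1 ω) ∂P) =
          fun t => ∫ ω, ρ ω * X ω ∂P + t * ∫ ω in s ∩ B, ρ ω ∂P := by
        funext t
        rw [← integral_indicator hA, ← integral_const_mul, ← integral_add hX.integrable_cost
          ((hρ_int.indicator hA).const_mul t)]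
        refine integral_congr_ae (Eventually.of_forall fun ω => ?_)
        simp only [← mul_indicator_one (s ∩ B) ρ ω]
        ring
      have d3 : HasDerivAt (fun t : ℝ => ∫ ω, ρ ω * (X ω + t * (s ∩ B).indicator 1 ω) ∂P)
          (∫ ω in s ∩ B, ρ ω ∂P) 0 := by
        rw [hcost]
        simpa using ((hasDerivAt_id (0 : ℝ)).mul_const (∫ ω in s ∩ B, ρ ω ∂P)).const_add
          (∫ ω, ρ ω * X ω ∂P)
      have d := (d1.sub (d3.const_mul lam)).sub (d2.const_mul mu)
      have hmax : IsLocalMax (fun t : ℝ => (∫ ω, U (X ω + t * (s ∩ B).indicator 1 ω) ∂P) -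
          lam * (∫ ω, ρ ω * (X ω + t * (s ∩ B).indicator 1 ω) ∂P) -
          mu * werm P m (fun ω => X ω + t * (s ∩ B).indicator 1 ω)) 0 := by
        filter_upwards [Metric.ball_mem_nhds (0 : ℝ) (half_pos hε)] with t ht
        rw [Metric.mem_ball, dist_zero_right, Real.norm_eq_abs, abs_lt] at ht
        have := hopt _ (hX.add_indicator hU hmaj hρ_int hε hA hAX ht.1.le)
        simpa using this
      have hz := hmax.hasDerivAt_eq_zero d
      have hsub : s ∩ B ⊆ B := inter_subset_right
      simp only [hΨ]
      rw [integral_sub (hi1.mono_set hsub) (hρ_int.const_mul lam).integrableOn,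
        integral_sub (hdB.mono_set hsub) (hwd.const_mul mu).integrableOn, integral_const_mul,
        integral_const_mul]
      linarith
    filter_upwards [(ae_restrict_iff' hBm).1 hzero] with ω hω hle
    exact hω hle
  filter_upwards [hX.pos, ae_all_iff.2 key] with ω h1 h2
  obtain ⟨n, hn⟩ := exists_nat_one_div_lt h1
  exact ⟨h1, h2 n hn.le⟩

/-- At `y = 0` strictness comes from a second tangent: the one at `z/2` meets the vertical axis
strictly below the one at `z`, and it bounds `U` near `0`. -/
theorem extUtility_lt_tangent (hU : IsUtility U) {y z : ℝ} (hz : 0 < z) (hy : 0 ≤ y)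
    (hne : y ≠ z) : extUtility U y < ((U z + deriv U z * (y - z) : ℝ) : EReal) := by
  rcases hy.eq_or_lt with rfl | hy
  · rw [extUtility, if_neg (lt_irrefl _)]
    have hw : 0 < z / 2 := by positivity
    have h1 := hU.lt_tangent hz hw (by linarith)
    have h2 := hU.deriv_strictAntiOn hw hz (by linarith)
    have h3 := hU.deriv_pos hw
    set d := (U z + deriv U z * (0 - z)) - (U (z / 2) - deriv U (z / 2) * (z / 2)) with hd
    have hd0 : 0 < d := by
      have := mul_lt_mul_of_pos_right h2 hw
      rw [hd]; linarith
    -- At this point the tangent at `z/2` has climbed from its intercept by half of the difference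
    -- `d` of intercepts.
    have hy : 0 < d / (2 * deriv U (z / 2)) := by positivity
    refine lt_of_le_of_lt (iInf₂_le (f := fun z (_ : z ∈ Ioi (0 : ℝ)) => (U z : EReal)) _ hy) ?_
    rw [EReal.coe_lt_coe_iff]
    have h4 := hU.le_tangent hw hy
    have h5 : deriv U (z / 2) * (d / (2 * deriv U (z / 2))) = d / 2 := by field_simp
    rw [mul_sub, h5] at h4
    linarith
  · rw [extUtility, if_pos hy, EReal.coe_lt_coe_iff]
    exact hU.lt_tangent hz hy hne

theorem extUtility_le_tangent (hU : IsUtility U) {y z : ℝ} (hz : 0 < z) (hy : 0 ≤ y) :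
    extUtility U y ≤ ((U z + deriv U z * (y - z) : ℝ) : EReal) := by
  rcases eq_or_ne y z with rfl | h
  · simp [extUtility, hz]
  · exact (extUtility_lt_tangent hU hz hy h).le

theorem measurable_extUtility (hU : IsUtility U) : Measurable (extUtility U) := by
  classical
  have h : Measurable (fun y => if y ∈ Ioi (0 : ℝ) then U y else 0) :=
    hU.continuousOn.measurable_piecewise continuousOn_const measurableSet_Ioi
  have h2 : Measurable (fun y => if y ∈ Ioi (0 : ℝ) then
      (((if y ∈ Ioi (0 : ℝ) then U y else 0 : ℝ)) : EReal)
      else ⨅ z ∈ Ioi (0 : ℝ), (U z : EReal)) :=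
    Measurable.ite measurableSet_Ioi (measurable_coe_real_ereal.comp h) measurable_const
  convert h2 using 1
  funext y
  by_cases hy : 0 < y <;> simp [extUtility, hy]

/-- If a positive random variable `X` has integrable utility and integrable tangents dominate the
utility of `Y` with nonpositive mean increment, then `Y` is not better than `X`. -/
theorem expectedUtility_le_of_tangent (hU : IsUtility U)
    (hpos : ∀ᵐ ω ∂P, 0 < X ω) (hUX : Integrable (fun ω => U (X ω)) P) (hY : Y ∈ L0Plus P)
    (hG : Integrable (fun ω => deriv U (X ω) * (Y ω - X ω)) P)
    (hG0 : ∫ ω, deriv U (X ω) * (Y ω - X ω) ∂P ≤ 0) :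
    expectedUtility P U Y ≤ expectedUtility P U X ∧
      (expectedUtility P U X ≤ expectedUtility P U Y → Y =ᵐ[P] X) := by
  rw [expectedUtility_eq hpos hUX]
  have hEm : Measurable fun ω => extUtility U (Y ω) := (measurable_extUtility hU).comp hY.1
  -- An infinite negative part gives expected utility `⊥`, even against an infinite positive part;
  -- otherwise the extended utility of `Y` is a.s. finite.
  by_cases htop : ∫⁻ ω, (-extUtility U (Y ω)).toENNReal ∂P = ⊤
  · have hbot : expectedUtility P U Y = ⊥ := by
      rw [expectedUtility, htop, EReal.coe_ennreal_top, EReal.sub_top]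
    rw [hbot]
    exact ⟨bot_le, fun h => absurd (le_bot_iff.1 h) (EReal.coe_ne_bot _)⟩
  set w : Ω → ℝ := fun ω => (extUtility U (Y ω)).toReal with hw
  set T : Ω → ℝ := fun ω => U (X ω) + deriv U (X ω) * (Y ω - X ω) with hT
  have hTi : Integrable T P := hUX.add hG
  have hnm : Measurable fun ω => (-extUtility U (Y ω)).toENNReal := hEm.neg.ereal_toENNReal
  have hEw : ∀ᵐ ω ∂P, extUtility U (Y ω) = (w ω : EReal) := by
    filter_upwards [ae_lt_top hnm htop, hpos, hY.2] with ω h1 h2 h3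
    refine (EReal.coe_toReal ?_ ?_).symm
    · exact ((extUtility_le_tangent hU h2 h3).trans_lt (EReal.coe_lt_top _)).ne
    · intro h
      rw [h] at h1
      simp at h1
  have hwT : ∀ᵐ ω ∂P, w ω ≤ T ω := by
    filter_upwards [hEw, hpos, hY.2] with ω h1 h2 h3
    have := extUtility_le_tangent hU h2 h3
    rwa [h1, EReal.coe_le_coe_iff] at this
  have hwm : Measurable w := hEm.ereal_toReal
  have hneg : Integrable (fun ω => max (-w ω) 0) P := by
    refine ⟨(hwm.neg.max measurable_const).aestronglyMeasurable, ?_⟩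
    have hnn : 0 ≤ᵐ[P] fun ω => max (-w ω) 0 := Eventually.of_forall fun ω => le_max_right _ _
    rw [hasFiniteIntegral_iff_ofReal hnn]
    refine lt_of_le_of_lt (le_of_eq (lintegral_congr_ae ?_)) (lt_top_iff_ne_top.2 htop)
    filter_upwards [hEw] with ω h1
    rw [h1, ← EReal.coe_neg]
    simp [EReal.toENNReal]
  have hwi : Integrable w P := by
    refine integrable_of_le_of_le hwm.aestronglyMeasurable
      (Eventually.of_forall fun ω => ?_) hwT hneg.neg hTi
    simp only [Pi.neg_apply]
    linarith [le_max_left (-w ω) 0]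
  have hEU : expectedUtility P U Y = ((∫ ω, w ω ∂P : ℝ) : EReal) :=
    lintegral_toENNReal_sub_eq_integral hEw hwi
  have hTle : ∫ ω, T ω ∂P ≤ ∫ ω, U (X ω) ∂P := by
    simp only [hT]
    rw [integral_add hUX hG]
    linarith
  rw [hEU, EReal.coe_le_coe_iff, EReal.coe_le_coe_iff]
  refine ⟨(integral_mono_ae hwi hTi hwT).trans hTle, fun h => ?_⟩
  have hz : ∫ ω, (T ω - w ω) ∂P = 0 := by
    refine le_antisymm ?_ (integral_nonneg_of_ae (hwT.mono fun ω h => sub_nonneg.2 h))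
    rw [integral_sub hTi hwi]
    linarith
  have hz2 := (integral_eq_zero_iff_of_nonneg_ae (hwT.mono fun ω h => sub_nonneg.2 h)
    (hTi.sub hwi)).1 hz
  filter_upwards [hz2, hEw, hpos, hY.2] with ω h1 h2 h3 h4
  by_contra hne
  have h5 := extUtility_lt_tangent hU h3 h4 hne
  rw [h2, EReal.coe_lt_coe_iff] at h5
  have h6 : T ω - w ω = 0 := h1
  simp only [hT] at h6
  linarith

/-- The first-order condition and complementary slackness are sufficient for optimality. -/
theorem solvesUniquely_of_firstOrderCondition [IsProbabilityMeasure P] [IsProbabilityMeasure m]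
    (hU : IsUtility U) {κ : ℝ} (hmaj : HasMajorant P ρ U κ) (hρ_meas : Measurable ρ)
    (hρ_pos : ∀ᵐ ω ∂P, 0 < ρ ω) (hρ_int : Integrable ρ P)
    (h0 : 0 < a₀) (h01 : a₀ < a₁) (hm : m (Icc a₀ a₁) = 1) (hx : 0 < x) (hX : X ∈ L0Plus P)
    (hlam : 0 < lam) (hmu : 0 ≤ mu) (hfoc : FirstOrderCondition P m ρ U lam mu X)
    (hcost : cost P ρ X = ENNReal.ofReal x) (hrisk : werm P m X ≤ γ)
    (hslack : mu * (werm P m X - γ) = 0) :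
    SolvesUniquely P U (riskFeasible P m ρ x γ) X := by
  have hXaff : X ∈ affordable P ρ x := ⟨hX, hcost.le⟩
  obtain ⟨hXi, -⟩ := integrable_cost_of_affordable hρ_meas hρ_pos hx hXaff
  have hpos : ∀ᵐ ω ∂P, 0 < X ω := hfoc.mono fun ω h => h.1
  have hnn : ∀ᵐ ω ∂P, 0 ≤ ρ ω * X ω := by
    filter_upwards [hρ_pos, hpos] with ω h1 h2
    positivity
  have hXx : ∫ ω, ρ ω * X ω ∂P = x := by
    rw [cost_eq hnn hXi] at hcost
    exact (ENNReal.ofReal_eq_ofReal_iff (integral_nonneg_of_ae hnn) hx.le).1 hcost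
  have hwneg : ∀ᵐ ω ∂P, wermDeriv P m X ω < 0 := hX.2.mono fun ω h => wermDeriv_neg hX h0 hm h
  -- The tangent at `X` evaluated at `1`, together with `U'(X) ≤ λρ` and `U'(X) X ≥ 0`, gives the
  -- integrable minorant `U(1) - λρ`.
  have hadm : Admissible P ρ U X := by
    refine Admissible.of_le hU hmaj hX.1 hpos hXi (g := fun ω => U 1 - lam * ρ ω)
      ((integrable_const _).sub (hρ_int.const_mul lam)) ?_
    filter_upwards [hfoc, hwneg] with ω h1 h2
    have h3 := hU.le_tangent h1.1 one_pos
    have h4 := mul_pos (hU.deriv_pos h1.1) h1.1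
    have h5 := mul_nonneg hmu (neg_pos.2 h2).le
    linarith [h1.2]
  have main : ∀ Y ∈ riskFeasible P m ρ x γ, expectedUtility P U Y ≤ expectedUtility P U X ∧
      (expectedUtility P U X ≤ expectedUtility P U Y → Y =ᵐ[P] X) := by
    rintro Y ⟨hY, hYγ⟩
    obtain ⟨hYi, hYx⟩ := integrable_cost_of_affordable hρ_meas hρ_pos hx hY
    have hc : Integrable (fun ω => lam * (ρ ω * Y ω - ρ ω * X ω)) P :=
      (hYi.sub hXi).const_mul lam
    have hcle : ∫ ω, lam * (ρ ω * Y ω - ρ ω * X ω) ∂P ≤ 0 := by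
      rw [integral_const_mul, integral_sub hYi hXi, hXx]
      exact mul_nonpos_of_nonneg_of_nonpos hlam.le (by linarith)
    -- A feasible `Z` need not be integrable under `P`, so boundedness of `h'(X)` is not enough.
    -- Positivity of `U'` in the first-order condition gives `-μ h'(X) ≤ λρ`, and the finite cost
    -- dominates.
    have hrw : ∀ Z : Ω → ℝ, Measurable Z → (∀ᵐ ω ∂P, 0 ≤ Z ω) →
        Integrable (fun ω => ρ ω * Z ω) P → 0 < mu →
        Integrable (fun ω => wermDeriv P m X ω * Z ω) P := by
      intro Z hZ hZ0 hZi hmu'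
      refine (hZi.const_mul (lam / mu)).mono'
        ((measurable_wermDeriv hX.1).mul hZ).aestronglyMeasurable ?_
      filter_upwards [hfoc, hwneg, hZ0] with ω h1 h2 h3
      rw [norm_mul, Real.norm_of_nonpos h2.le, Real.norm_of_nonneg h3, ← mul_assoc]
      refine mul_le_mul_of_nonneg_right ?_ h3
      rw [div_mul_eq_mul_div, le_div_iff₀ hmu']
      linarith [hU.deriv_pos h1.1, h1.2]
    have hr : Integrable (fun ω => mu * (wermDeriv P m X ω * (Y ω - X ω))) P ∧
        ∫ ω, mu * (wermDeriv P m X ω * (Y ω - X ω)) ∂P ≤ 0 := by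
      rcases hmu.eq_or_lt with h | hmu'
      · simp [← h]
      · have hi : Integrable (fun ω => wermDeriv P m X ω * (Y ω - X ω)) P := by
          refine ((hrw Y hY.1.1 hY.1.2 hYi hmu').sub (hrw X hX.1 hX.2 hXi hmu')).congr
            (Eventually.of_forall fun ω => ?_)
          simp only [Pi.sub_apply]; ring
        refine ⟨hi.const_mul mu, ?_⟩
        rw [integral_const_mul]
        have h1 := werm_tangent hX hY.1 h0 h01 hm hi
        have h2 : werm P m X = γ := by
          rcases mul_eq_zero.1 hslack with h | h <;> linarith
        exact mul_nonpos_of_nonneg_of_nonpos hmu (by linarith)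
    have hGeq : (fun ω => lam * (ρ ω * Y ω - ρ ω * X ω) +
        mu * (wermDeriv P m X ω * (Y ω - X ω))) =ᵐ[P]
        fun ω => deriv U (X ω) * (Y ω - X ω) := by
      filter_upwards [hfoc] with ω h1
      have : deriv U (X ω) = mu * wermDeriv P m X ω + lam * ρ ω := by linarith [h1.2]
      rw [this]; ring
    refine expectedUtility_le_of_tangent hU hpos hadm.integrable_utility hY.1
      ((hc.add hr.1).congr hGeq) ?_
    rw [← integral_congr_ae hGeq, integral_add hc hr.1]
    linarith [hr.2]
  exact ⟨⟨⟨hXaff, hrisk⟩, fun Y hY => (main Y hY).1⟩,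
    fun Y hY => (main Y hY.1).2 (hY.2 X ⟨hXaff, hrisk⟩)⟩

theorem FirstOrderCondition.congr (h : X =ᵐ[P] Y)
    (hX : FirstOrderCondition P m ρ U lam mu X) : FirstOrderCondition P m ρ U lam mu Y := by
  filter_upwards [hX, h, wermDeriv_congr (m := m) h] with ω h1 h2 h3
  rwa [h2, h3] at h1

theorem cost_congr (h : X =ᵐ[P] Y) : cost P ρ X = cost P ρ Y := by
  refine lintegral_congr_ae ?_
  filter_upwards [h] with ω hω
  rw [hω]

/-- Existence of a wealth satisfying the optimality system. -/
theorem exists_firstOrderCondition [IsProbabilityMeasure P] [IsProbabilityMeasure m]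
    (hU : IsUtility U) (hρ_meas : Measurable ρ) (hρ_pos : ∀ᵐ ω ∂P, 0 < ρ ω)
    (hρ_int : Integrable ρ P) (hmaj : ∀ κ > 0, HasMajorant P ρ U κ)
    (h0 : 0 < a₀) (h01 : a₀ < a₁) (hm : m (Icc a₀ a₁) = 1) (hx : 0 < x)
    (hγ : minRisk P m ρ x < (γ : EReal)) :
    ∃ (X : Ω → ℝ) (lam mu : ℝ), X ∈ L0Plus P ∧ 0 < lam ∧ 0 ≤ mu ∧
      FirstOrderCondition P m ρ U lam mu X ∧ cost P ρ X = ENNReal.ofReal x ∧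
      werm P m X ≤ γ ∧ mu * (werm P m X - γ) = 0 := by
  obtain ⟨X, lam, mu, hX, -, hXγ, -, hmu, hs1, hs2, hopt⟩ :=
    exists_lagrange_optimizer hU hρ_meas hρ_pos hmaj h0 h01 hm
      (exists_slater hρ_meas hρ_pos hρ_int hU (hmaj 1 one_pos) h0 h01 hm hx hγ)
  have hfoc := firstOrderCondition_of_lagrange hU (hmaj 1 one_pos) hρ_int h0 h01 hm hX hopt
  have hlam : 0 < lam := by
    obtain ⟨ω, h1, h2⟩ := (hfoc.and hρ_pos).exists
    have h3 := hU.deriv_pos h1.1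
    have h4 := mul_nonneg hmu (neg_pos.2 (wermDeriv_neg hX.mem_L0Plus h0 hm h1.1.le)).le
    exact pos_of_mul_pos_left (show 0 < lam * ρ ω by linarith [h1.2]) h2.le
  have hXx : ∫ ω, ρ ω * X ω ∂P = x := by
    rcases mul_eq_zero.1 hs1 with h | h <;> linarith
  refine ⟨X, lam, mu, hX.mem_L0Plus, hlam, hmu, hfoc, ?_, hXγ, hs2⟩
  rw [cost_eq _ hX.integrable_cost, hXx]
  filter_upwards [hρ_pos, hX.pos] with ω h1 h2
  positivity

end Optimality

end WERM

/-! ### The main theorem. -/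

theorem mainTheorem7 {Ω : Type*} [MeasurableSpace Ω] (P : Measure Ω) [IsProbabilityMeasure P]
    (ρ : Ω → ℝ) (hρ_meas : Measurable ρ) (hρ_pos : ∀ᵐ ω ∂P, 0 < ρ ω) (hρ_int : Integrable ρ P)
    (U : ℝ → ℝ) (hU : WERM.IsUtility U) (hAE : WERM.asymptoticElasticity U < 1)
    (hfin : ∃ x : ℝ, 0 < x ∧ WERM.euValue P ρ U x < ⊤)
    (m : Measure ℝ) [IsProbabilityMeasure m]
    (hm : ∃ a₀ a₁ : ℝ, 0 < a₀ ∧ a₀ < a₁ ∧ m (Icc a₀ a₁) = 1)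
    (x : ℝ) (hx : 0 < x) :
    ∃ X₀ : Ω → ℝ, WERM.SolvesUniquely P U (WERM.affordable P ρ x) X₀ ∧
      ∀ γ : ℝ, WERM.minRisk P m ρ x < (γ : EReal) → γ < WERM.werm P m X₀ →
        (∃ X : Ω → ℝ, WERM.SolvesUniquely P U (WERM.riskFeasible P m ρ x γ) X) ∧
        ∀ X ∈ WERM.L0Plus P,
          (WERM.Solves P U (WERM.riskFeasible P m ρ x γ) X ↔
            ∃ lam mu : ℝ, 0 < lam ∧ 0 < mu ∧ WERM.FirstOrderCondition P m ρ U lam mu X ∧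
              WERM.cost P ρ X = ENNReal.ofReal x ∧ WERM.werm P m X = γ) := by
  open WERM in
  obtain ⟨a₀, a₁, h0, h01, hm⟩ := hm
  have hmaj : ∀ κ > 0, HasMajorant P ρ U κ := fun κ hκ =>
    hasMajorant hρ_meas hρ_pos hρ_int hU hAE hfin hκ
  have hsuff : ∀ {X : Ω → ℝ} {lam mu γ : ℝ}, X ∈ L0Plus P → 0 < lam → 0 ≤ mu →
      FirstOrderCondition P m ρ U lam mu X → cost P ρ X = ENNReal.ofReal x → werm P m X ≤ γ →
      mu * (werm P m X - γ) = 0 → SolvesUniquely P U (riskFeasible P m ρ x γ) X :=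
    fun hX hlam hmu hfoc hc hr hs => solvesUniquely_of_firstOrderCondition hU (hmaj 1 one_pos)
      hρ_meas hρ_pos hρ_int h0 h01 hm hx hX hlam hmu hfoc hc hr hs
  -- Risks of nonnegative wealths are nonpositive, so the level `1` makes the risk constraint
  -- vacuous and the unconstrained problem is a special case.
  have hall : riskFeasible P m ρ x 1 = affordable P ρ x := by
    ext X
    exact ⟨fun h => h.1, fun h => ⟨h, (werm_nonpos h.1 h0 hm).trans zero_le_one⟩⟩
  have hmin : minRisk P m ρ x < ((1 : ℝ) : EReal) := by
    have hzero : (fun _ : Ω => (0 : ℝ)) ∈ affordable P ρ x :=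
      ⟨⟨measurable_const, by simp⟩, by simp [cost]⟩
    refine lt_of_le_of_lt
      (iInf₂_le (f := fun X (_ : X ∈ affordable P ρ x) => (werm P m X : EReal)) _ hzero) ?_
    rw [EReal.coe_lt_coe_iff]
    exact (werm_nonpos hzero.1 h0 hm).trans_lt one_pos
  obtain ⟨X₀, lam₀, mu₀, hX₀, hlam₀, hmu₀, hfoc₀, hc₀, hr₀, hs₀⟩ :=
    exists_firstOrderCondition hU hρ_meas hρ_pos hρ_int hmaj h0 h01 hm hx hmin
  have hsol₀ : SolvesUniquely P U (affordable P ρ x) X₀ := by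
    rw [← hall]
    exact hsuff hX₀ hlam₀ hmu₀ hfoc₀ hc₀ hr₀ hs₀
  refine ⟨X₀, hsol₀, fun γ hγ hγ₀ => ?_⟩
  obtain ⟨X, lam, mu, hX, hlam, hmu, hfoc, hc, hr, hs⟩ :=
    exists_firstOrderCondition hU hρ_meas hρ_pos hρ_int hmaj h0 h01 hm hx hγ
  have hsol := hsuff hX hlam hmu hfoc hc hr hs
  -- With `μ = 0` the same system certifies `X` as unconstrained optimum, so `X = X₀` a.s. and
  -- `h(X₀) ≤ γ`, against the choice of `γ`.
  have hmu_pos : 0 < mu := by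
    refine hmu.lt_of_ne fun h => ?_
    subst h
    have hsol' : SolvesUniquely P U (affordable P ρ x) X := by
      rw [← hall]
      exact hsuff hX hlam le_rfl hfoc hc ((werm_nonpos hX h0 hm).trans zero_le_one) (zero_mul _)
    have := werm_congr (m := m) (hsol₀.2 X hsol'.1)
    linarith
  have hXγ : werm P m X = γ := by
    rcases mul_eq_zero.1 hs with h | h <;> linarith
  refine ⟨⟨X, hsol⟩, fun Z hZ => ⟨fun hZs => ?_, ?_⟩⟩
  · have hXZ := (hsol.2 Z hZs).symm
    exact ⟨lam, mu, hlam, hmu_pos, hfoc.congr hXZ, (cost_congr hXZ).symm.trans hc,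
      (werm_congr hXZ).symm.trans hXγ⟩
  · rintro ⟨lam', mu', hlam', hmu', hfoc', hc', hr'⟩
    exact (hsuff hZ hlam' hmu'.le hfoc' hc' hr'.le (by rw [hr', sub_self, mul_zero])).1
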